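/- Let $m,n\in\mathbb{N}$, $\alpha\in\mathbb{N}_0$, and let $A\in\mathbb{Z}^{m\times m}$ be symmetric and positive definite. Let $P$ be a polynomial with complex coefficients in the entries of an $m\times n$ matrix such that $P(UN)=(\det N)^{\alpha}P(U)$ for all $U\in\mathbb{C}^{m\times n}$, $N\in\mathbb{C}^{n\times n}$. Put $$\operatorname{tr}\Delta_A=\sum_{\nu=1}^{n}\sum_{\mu,\rho=1}^{m}\frac{\partial}{\partial U_{\mu\nu}}(A^{-1})_{\mu\rho}\frac{\partial}{\partial U_{\rho\nu}},\qquad p=\exp\Bigl(-\frac{\operatorname{tr}\Delta_A}{8\pi}\Bigr)P=\sum_{k\ge 0}\frac{(-1/8\pi)^k}{k!}(\operatorname{tr}\Delta_A)^kP .$$ Let $\mathbb{H}_n$ be the set of symmetric $Z=X+iY\in\mathbb{C}^{n\times n}$ with $Y$ positive definite, $e(z)=\exp(2\pi i z)$, and let $Y^{1/2}$ be the positive definite square root of $Y$. For $H,K\in\mathbb{R}^{m\times n}$ define $$\theta_{H,K}(Z)=(\det Y)^{-\alpha/2}\sum_{U\in H+\mathbb{Z}^{m\times n}}p(UY^{1/2})\,e\bigl(\operatorname{tr}(U^{\mathsf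 T}AUZ)/2+\operatorname{tr}(K^{\mathsf T}AU)\bigr)\qquad(Z\in\mathbb{H}_n).$$ There is a continuous branch of $(\det Z)^{1/2}$ on the connected set $\mathbb{H}_n$ with value $i^{n/2}=e^{\pi i n/4}$ at $Z=iI$; write $(\det Z)^{m/2+\alpha}=\bigl((\det Z)^{1/2}\bigr)^{m+2\alpha}$ for this branch, and $i^{-mn/2}=e^{-\pi i mn/4}$. If $m$ is even or $n=1$, this $(\det Z)^{m/2+\alpha}$ is the principal power. Then the series $\theta_{H,K}(Z)$ converge absolutely, $A^{-1}\mathbb{Z}^{m\times n}/\mathbb{Z}^{m\times n}$ is finite, and for all $H,K\in\mathbb{R}^{m\times n}$ and $Z\in\mathbb{H}_n$ one has $-Z^{-1}\in\mathbb{H}_n$ and $$\theta_{H,K}(-Z^{-1})=i^{-mn/2}(\det A)^{-n/2}(\det Z)^{m/2+\alpha}\,e\bigl(\operatorname{tr}(H^{\mathsf T}AK)\bigr)\sum_{J\in A^{-1}\mathbb{Z}^{m\times n}\bmod \mathbb{Z}^{m\times n}}\theta_{J+K,-H}(Z),$$ where $J$ runs over any complete system of representatives. Moreover, if $(\operatorname{tr}\Delta_A)P=0$,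 then $\theta_{H,K}(Z)=\sum_{U\in H+\mathbb{Z}^{m\times n}}P(U)\,e\bigl(\operatorname{tr}(U^{\mathsf T}AUZ)/2+\operatorname{tr}(K^{\mathsf T}AU)\bigr)$, and this is holomorphic on $\mathbb{H}_n$. If $8\mid m$, $\det A=1$ and the diagonal entries of $A$ are even, then $\theta_{0,0}$ transforms under the generators of the Siegel modular group with weight $m/2+\alpha$: $\theta_{0,0}(Z+S)=\theta_{0,0}(Z)$ for all symmetric $S\in\mathbb{Z}^{n\times n}$ and $\theta_{0,0}(-Z^{-1})=(\det Z)^{m/2+\alpha}\,\theta_{0,0}(Z)$. -/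

import Mathlib

open scoped MatrixOrder

noncomputable section

namespace SiegelTheta

/-- The Siegel upper half-space: symmetric complex matrices with positive definite imaginary
part. -/
def upperHalfSpace (n : ℕ) : Set (Matrix (Fin n) (Fin n) ℂ) :=
  {Z | Z.IsSymm ∧ (Z.map Complex.im).PosDef}

/-- `e(z) = exp(2πiz)`. -/
def e (z : ℂ) : ℂ := Complex.exp (2 * Real.pi * Complex.I * z)

/-- An integer matrix, viewed over the reals. -/
def toR {k l : ℕ} (B : Matrix (Fin k) (Fin l) ℤ) : Matrix (Fin k) (Fin l) ℝ :=
  B.map (fun a => (a : ℝ))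

/-- A real matrix, viewed over the complex numbers. -/
def toC {k l : ℕ} (B : Matrix (Fin k) (Fin l) ℝ) : Matrix (Fin k) (Fin l) ℂ :=
  B.map (fun a => (a : ℂ))

/-- The value of a polynomial in the `m * n` matrix entries at a complex matrix. -/
def evalMatrix {m n : ℕ} (P : MvPolynomial (Fin m × Fin n) ℂ)
    (U : Matrix (Fin m) (Fin n) ℂ) : ℂ :=
  MvPolynomial.eval (fun ij => U ij.1 ij.2) P

/-- The homogeneity property `P(UN) = (det N)^α P(U)` for all complex `U` and `N`. -/
def IsDetHomogeneous {m n : ℕ} (α : ℕ) (P : MvPolynomial (Fin m × Fin n) ℂ) : Prop :=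
  ∀ (U : Matrix (Fin m) (Fin n) ℂ) (N : Matrix (Fin n) (Fin n) ℂ),
    evalMatrix P (U * N) = N.det ^ α * evalMatrix P U

/-- `tr Δ_A = ∑_ν ∑_{μ,ρ} ∂/∂U_{μν} (A⁻¹)_{μρ} ∂/∂U_{ρν}`, acting on polynomials. -/
def trLaplace {m n : ℕ} (A : Matrix (Fin m) (Fin m) ℤ)
    (P : MvPolynomial (Fin m × Fin n) ℂ) : MvPolynomial (Fin m × Fin n) ℂ :=
  ∑ ν : Fin n, ∑ μ : Fin m, ∑ ρ : Fin m,
    MvPolynomial.pderiv (μ, ν)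
      (MvPolynomial.C ((toC (toR A))⁻¹ μ ρ) * MvPolynomial.pderiv (ρ, ν) P)

/-- `exp(c tr Δ_A)(P) = ∑_k (c^k / k!) (tr Δ_A)^k (P)`; only finitely many terms are nonzero. -/
def expTrLaplace {m n : ℕ} (A : Matrix (Fin m) (Fin m) ℤ) (c : ℂ)
    (P : MvPolynomial (Fin m × Fin n) ℂ) : MvPolynomial (Fin m × Fin n) ℂ :=
  ∑ᶠ k : ℕ, MvPolynomial.C (c ^ k / (k.factorial : ℂ)) * (trLaplace A)^[k] P

/-- The function `p = exp(-tr Δ_A / 8π)(P)` on real matrices. -/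
def modifiedPoly {m n : ℕ} (A : Matrix (Fin m) (Fin m) ℤ)
    (P : MvPolynomial (Fin m × Fin n) ℂ) (U : Matrix (Fin m) (Fin n) ℝ) : ℂ :=
  evalMatrix (expTrLaplace A (-1 / (8 * (Real.pi : ℂ))) P) (toC U)

/-- The exponential factor `e(tr(Uᵀ A U Z) / 2 + tr(Kᵀ A U))`. -/
def expFactor {m n : ℕ} (A : Matrix (Fin m) (Fin m) ℤ) (K : Matrix (Fin m) (Fin n) ℝ)
    (Z : Matrix (Fin n) (Fin n) ℂ) (U : Matrix (Fin m) (Fin n) ℝ) : ℂ :=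
  e ((toC (U.transpose * toR A * U) * Z).trace / 2 +
    (((K.transpose * toR A * U).trace : ℝ) : ℂ))

/-- The summand `f(U Y^{1/2}) e(tr(Uᵀ A U Z) / 2 + tr(Kᵀ A U))` with `Y = Im Z`. -/
def thetaTerm {m n : ℕ} (f : Matrix (Fin m) (Fin n) ℝ → ℂ) (A : Matrix (Fin m) (Fin m) ℤ)
    (K : Matrix (Fin m) (Fin n) ℝ) (Z : Matrix (Fin n) (Fin n) ℂ)
    (U : Matrix (Fin m) (Fin n) ℝ) : ℂ :=
  f (U * CFC.sqrt (Z.map Complex.im)) * expFactor A K Z U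

/-- The theta series with characteristics `H`, `K` associated with `f`, `A` and `l`:
`(det Y)^{-l/2} ∑_{U ∈ H + ℤ^{m×n}} f(U Y^{1/2}) e(tr(Uᵀ A U Z) / 2 + tr(Kᵀ A U))`. -/
def theta {m n : ℕ} (l : ℤ) (f : Matrix (Fin m) (Fin n) ℝ → ℂ)
    (A : Matrix (Fin m) (Fin m) ℤ) (H K : Matrix (Fin m) (Fin n) ℝ)
    (Z : Matrix (Fin n) (Fin n) ℂ) : ℂ :=
  (((Z.map Complex.im).det ^ (-(l : ℝ) / 2) : ℝ) : ℂ) *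
    ∑' R : Matrix (Fin m) (Fin n) ℤ, thetaTerm f A K Z (H + toR R)

/-- `𝒥` is a complete system of representatives of `A⁻¹ ℤ^{m×n}` modulo `ℤ^{m×n}`. -/
def IsRepSystem {m n : ℕ} (A : Matrix (Fin m) (Fin m) ℤ)
    (𝒥 : Finset (Matrix (Fin m) (Fin n) ℝ)) : Prop :=
  (∀ J ∈ 𝒥, ∃ R : Matrix (Fin m) (Fin n) ℤ, J = (toR A)⁻¹ * toR R) ∧
    ∀ R : Matrix (Fin m) (Fin n) ℤ, ∃! J : Matrix (Fin m) (Fin n) ℝ,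
      J ∈ 𝒥 ∧ ∃ T : Matrix (Fin m) (Fin n) ℤ, (toR A)⁻¹ * toR R - J = toR T

/-- `r` is the continuous branch of `(det Z)^{1/2}` on the (connected) Siegel upper half-space
whose value at `iI` is `i^{n/2} = exp(πin/4)`. -/
def IsDetRoot (n : ℕ) (r : Matrix (Fin n) (Fin n) ℂ → ℂ) : Prop :=
  ContinuousOn r (upperHalfSpace n) ∧
    (∀ Z ∈ upperHalfSpace n, r Z ^ 2 = Z.det) ∧
    r (Complex.I • (1 : Matrix (Fin n) (Fin n) ℂ)) = Complex.I ^ ((n : ℂ) / 2)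

end SiegelTheta

end

/-! The theorem is Poisson summation for a polynomial times a Gaussian, together with the fact that
the polynomial reproduces itself under the Fourier transform.

Read matrices as vectors. By homogeneity of `P`, the square root of `Y` and the factor `(det
Y)^{-α/2}` cancel (`modifiedPoly_mul_sqrt`), and the theta series becomes the lattice sum of
`q_Y(U)` times the Gaussian of the form `A ⊗ (-iZ)`, where `q_Y = exp(-(1/8π) (A⁻¹ ⊗ Y⁻¹)∂∂) P`
(`theta_eq_tsum`). The real part of this form is `A ⊗ Y`, which is positive definite; this gives
absolute convergence.

Integrating by parts against the Gaussian of `B` gives a recursion on polynomials whose only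
solution, up to the value at `1`, is `p ↦ (exp((1/4π) B⁻¹∂∂) p)(i B⁻¹ v)`
(`functional_eq_eval_heat`, `gaussianFunctional_eq`). So the Fourier transform of polynomial times
Gaussian is again of that kind. At `-Z⁻¹` one has `B⁻¹ = A⁻¹ ⊗ (-iZ)`. The operators compose by
adding their matrices (`heat_heat`), and the identity `Z Y⁻¹ Z = (X Y⁻¹ X + Y) + 2iZ`
(`mul_im_inv_mul_self`) shows that the total is `-(1/8π) A⁻¹ ⊗ (Z Y⁻¹ Z)`, while the point of
evaluation is `VZ`. Homogeneity with `N = Z` turns this into `(det Z)^α q_Y(V)`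
(`heat_linComp_kronecker`, `poisson_term_eq`).

The remaining constant is a Gaussian integral. Its square is `1 / det B`; the sign is settled by
continuity on the convex set of all `Z` and by comparison at `iI`, a fixed point of `Z ↦ -Z⁻¹`
(`gaussInt_kronecker_neg_inv`). The dual lattice `A⁻¹ℤ^{m×n}` is then split into cosets of `ℤ^{m×n}`
(`tsum_eq_sum_isRepSystem`).

If `tr Δ_A` kills `P`, then `q_Y = P` on real matrices does not depend on `Y`, and the series may be
differentiated termwise. For even unimodular `A` there is one coset, the roots of unity are `1`, and
`tr(RᵀARS)` is even. -/

noncomputable section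

namespace SiegelTheta

open MvPolynomial Finset

/-! ### The operators `exp(∑ S_{ij} ∂_i ∂_j)` on polynomials -/

section Heat

variable {ι : Type*} [Fintype ι]

/-- The second order operator `∑ S_{ij} ∂_i ∂_j` on polynomials. -/
def quadDiff (S : Matrix ι ι ℂ) : MvPolynomial ι ℂ →ₗ[ℂ] MvPolynomial ι ℂ :=
  ∑ i, ∑ j, S i j • ((pderiv i).toLinearMap ∘ₗ (pderiv j).toLinearMap)

lemma quadDiff_apply (S : Matrix ι ι ℂ) (p : MvPolynomial ι ℂ) :
    quadDiff S p = ∑ i, ∑ j, S i j • pderiv i (pderiv j p) := by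
  simp [quadDiff, LinearMap.sum_apply]

lemma quadDiff_smul (c : ℂ) (S : Matrix ι ι ℂ) : quadDiff (c • S) = c • quadDiff S := by
  simp [quadDiff, mul_smul, Finset.smul_sum]

-- The commutator of two derivations is a derivation, so it vanishes once it kills the variables.
omit [Fintype ι] in
lemma pderiv_comm (i j : ι) (p : MvPolynomial ι ℂ) :
    pderiv i (pderiv j p) = pderiv j (pderiv i p) := by
  classical
  have h : ⁅(pderiv i : Derivation ℂ (MvPolynomial ι ℂ) (MvPolynomial ι ℂ)),
      (pderiv j : Derivation ℂ (MvPolynomial ι ℂ) (MvPolynomial ι ℂ))⁆ = 0 := by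
    apply MvPolynomial.derivation_ext
    intro k
    rw [Derivation.commutator_apply]
    simp only [pderiv_X, Derivation.zero_apply, Pi.single_apply]
    split_ifs <;> simp
  have h2 := congrArg (fun D => D p) h
  simpa [Derivation.commutator_apply, sub_eq_zero] using h2

lemma pderiv_quadDiff (S : Matrix ι ι ℂ) (k : ι) (p : MvPolynomial ι ℂ) :
    pderiv k (quadDiff S p) = quadDiff S (pderiv k p) := by
  simp only [quadDiff_apply, map_sum, Derivation.map_smul]
  refine sum_congr rfl fun i _ => sum_congr rfl fun j _ => ?_
  rw [pderiv_comm k i, pderiv_comm k j]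

/-- The first order operator `2 ∑_k S_{jk} ∂_k`. -/
def linDiff (S : Matrix ι ι ℂ) (j : ι) : MvPolynomial ι ℂ →ₗ[ℂ] MvPolynomial ι ℂ :=
  ∑ k, (2 * S j k) • (pderiv k).toLinearMap

lemma linDiff_apply (S : Matrix ι ι ℂ) (j : ι) (p : MvPolynomial ι ℂ) :
    linDiff S j p = ∑ k, (2 * S j k) • pderiv k p := by
  simp [linDiff, LinearMap.sum_apply]

/-- The commutator of a second order operator with multiplication by a variable has first order.
Symmetry of `S` merges the two cross terms into the factor `2` of `linDiff`. -/
lemma quadDiff_X_mul {S : Matrix ι ι ℂ} (hS : S.IsSymm) (j : ι) (p : MvPolynomial ι ℂ) :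
    quadDiff S (X j * p) = X j * quadDiff S p + linDiff S j p := by
  classical
  have h1 : ∀ k, pderiv k (X j * p) = X j * pderiv k p + (if j = k then p else 0) := by
    intro k
    rw [Derivation.leibniz, pderiv_X, Pi.single_apply]
    split_ifs with h <;> simp
  have h2 : ∀ i k, pderiv i (if j = k then p else 0) = if j = k then pderiv i p else 0 := by
    intro i k; split_ifs <;> simp
  have h3 : ∀ i k, S i k • pderiv i (pderiv k (X j * p)) = X j * (S i k • pderiv i (pderiv k p)) +
      ((if j = i then S i k • pderiv k p else 0) + (if j = k then S i k • pderiv i p else 0)) := by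
    intro i k
    rw [h1, map_add, h2, Derivation.leibniz, pderiv_X, Pi.single_apply]
    split_ifs <;> simp
    ring
  simp only [quadDiff_apply, h3, sum_add_distrib, ← mul_sum, linDiff_apply]
  congr 1
  have e1 : ∑ i, ∑ k, (if j = i then S i k • pderiv k p else 0) = ∑ k, S j k • pderiv k p := by
    rw [sum_comm]; simp
  have e2 : ∑ i, ∑ k, (if j = k then S i k • pderiv i p else 0) = ∑ k, S j k • pderiv k p := by
    simp only [sum_ite_eq, mem_univ, if_true]
    exact sum_congr rfl fun i _ => by rw [hS.apply]
  rw [e1, e2, ← sum_add_distrib]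
  exact sum_congr rfl fun i _ => by rw [← add_smul, two_mul]

lemma quadDiff_linDiff (S : Matrix ι ι ℂ) (S' : Matrix ι ι ℂ) (j : ι) (p : MvPolynomial ι ℂ) :
    quadDiff S (linDiff S' j p) = linDiff S' j (quadDiff S p) := by
  simp only [linDiff_apply, map_sum, map_smul, pderiv_quadDiff]

lemma quadDiff_pow_linDiff (S : Matrix ι ι ℂ) (j : ι) (k : ℕ) (p : MvPolynomial ι ℂ) :
    (quadDiff S ^ k) (linDiff S j p) = linDiff S j ((quadDiff S ^ k) p) := by
  induction k generalizing p with
  | zero => simp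
  | succ k ih => rw [pow_succ, Module.End.mul_apply, quadDiff_linDiff, ih]; rfl

/-- The commutator `L = [D, X_j]` itself commutes with `D`, hence `[D^(k+1), X_j] = (k+1) L D^k`. -/
lemma quadDiff_pow_X_mul {S : Matrix ι ι ℂ} (hS : S.IsSymm) (j : ι) (k : ℕ)
    (p : MvPolynomial ι ℂ) :
    (quadDiff S ^ (k + 1)) (X j * p) = X j * (quadDiff S ^ (k + 1)) p +
      ((k : ℂ) + 1) • linDiff S j ((quadDiff S ^ k) p) := by
  induction k generalizing p with
  | zero => simp [quadDiff_X_mul hS]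
  | succ k ih =>
    rw [pow_succ, Module.End.mul_apply, quadDiff_X_mul hS, map_add, ih, quadDiff_pow_linDiff]
    rw [← Module.End.mul_apply, ← pow_succ, ← Module.End.mul_apply (_ ^ k), ← pow_succ, add_assoc]
    congr 1
    push_cast
    module

/-- Local nilpotency makes the exponential a finite sum, and keeps the `finsum` in `heat` from
taking its junk value. By the commutator formula each further variable costs at most one more power.
-/
lemma quadDiff_pow_eventually_zero {S : Matrix ι ι ℂ} (hS : S.IsSymm) (p : MvPolynomial ι ℂ) :
    ∃ N, ∀ k, N ≤ k → (quadDiff S ^ k) p = 0 := by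
  induction p using MvPolynomial.induction_on with
  | C a =>
    refine ⟨1, fun k hk => ?_⟩
    obtain ⟨k, rfl⟩ := Nat.exists_eq_add_of_le' hk
    rw [pow_succ, Module.End.mul_apply, quadDiff_apply]
    simp
  | add p q hp hq =>
    obtain ⟨N, hN⟩ := hp
    obtain ⟨M, hM⟩ := hq
    refine ⟨max N M, fun k hk => ?_⟩
    rw [map_add, hN k (le_trans (le_max_left _ _) hk), hM k (le_trans (le_max_right _ _) hk),
      add_zero]
  | mul_X p j hp =>
    obtain ⟨N, hN⟩ := hp
    refine ⟨N + 1, fun k hk => ?_⟩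
    obtain ⟨k, rfl⟩ := Nat.exists_eq_add_of_le' (show 1 ≤ k by omega)
    rw [mul_comm, quadDiff_pow_X_mul hS, hN _ (by omega), hN _ (by omega)]
    simp

/-- `exp(∑ S_{ij} ∂_i ∂_j) p`, as a finite sum. -/
def heat (S : Matrix ι ι ℂ) (p : MvPolynomial ι ℂ) : MvPolynomial ι ℂ :=
  ∑ᶠ k : ℕ, ((k.factorial : ℂ)⁻¹) • (quadDiff S ^ k) p

lemma heat_eq_sum (S : Matrix ι ι ℂ) {p : MvPolynomial ι ℂ} {N : ℕ}
    (hN : ∀ k, N ≤ k → (quadDiff S ^ k) p = 0) :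
    heat S p = ∑ k ∈ range N, ((k.factorial : ℂ)⁻¹) • (quadDiff S ^ k) p := by
  refine finsum_eq_sum_of_support_subset _ fun k hk => ?_
  simp only [coe_range, Set.mem_Iio]
  by_contra h
  exact hk (by simp [hN k (not_lt.1 h)])

lemma heat_add {S : Matrix ι ι ℂ} (hS : S.IsSymm) (p q : MvPolynomial ι ℂ) :
    heat S (p + q) = heat S p + heat S q := by
  obtain ⟨N, hN⟩ := quadDiff_pow_eventually_zero hS p
  obtain ⟨M, hM⟩ := quadDiff_pow_eventually_zero hS q
  have hN' : ∀ k, max N M ≤ k → (quadDiff S ^ k) p = 0 :=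
    fun k hk => hN k (le_trans (le_max_left _ _) hk)
  have hM' : ∀ k, max N M ≤ k → (quadDiff S ^ k) q = 0 :=
    fun k hk => hM k (le_trans (le_max_right _ _) hk)
  rw [heat_eq_sum S hN', heat_eq_sum S hM', heat_eq_sum (N := max N M) S, ← sum_add_distrib]
  · simp
  · intro k hk
    rw [map_add, hN' k hk, hM' k hk, add_zero]

lemma heat_smul {S : Matrix ι ι ℂ} (hS : S.IsSymm) (c : ℂ) (p : MvPolynomial ι ℂ) :
    heat S (c • p) = c • heat S p := by
  obtain ⟨N, hN⟩ := quadDiff_pow_eventually_zero hS p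
  rw [heat_eq_sum S hN, heat_eq_sum (N := N) S, smul_sum]
  · simp [smul_comm c]
  · intro k hk
    rw [map_smul, hN k hk, smul_zero]

/-- `heat S` as a linear map, for symmetric `S`. -/
def heatHom {S : Matrix ι ι ℂ} (hS : S.IsSymm) : MvPolynomial ι ℂ →ₗ[ℂ] MvPolynomial ι ℂ where
  toFun := heat S
  map_add' := heat_add hS
  map_smul' := heat_smul hS

lemma heatHom_apply {S : Matrix ι ι ℂ} (hS : S.IsSymm) (p : MvPolynomial ι ℂ) :
    heatHom hS p = heat S p := rfl

lemma heat_of_quadDiff_eq_zero {S : Matrix ι ι ℂ} {p : MvPolynomial ι ℂ} (h : quadDiff S p = 0) :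
    heat S p = p := by
  rw [heat_eq_sum (N := 1)]
  · simp
  · intro k hk
    obtain ⟨k, rfl⟩ := Nat.exists_eq_add_of_le' hk
    rw [pow_succ, Module.End.mul_apply, h, map_zero]

lemma heat_one (S : Matrix ι ι ℂ) : heat S 1 = 1 :=
  heat_of_quadDiff_eq_zero (by simp [quadDiff_apply])

/-- This is `exp(D) X_j exp(-D) = X_j + [D, X_j]`: the higher commutators vanish, and `(k+1)/(k+1)!
= 1/k!`. -/
lemma heat_X_mul {S : Matrix ι ι ℂ} (hS : S.IsSymm) (j : ι) (p : MvPolynomial ι ℂ) :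
    heat S (X j * p) = X j * heat S p + linDiff S j (heat S p) := by
  obtain ⟨N, hN⟩ := quadDiff_pow_eventually_zero hS p
  have hN1 : ∀ k, N + 1 ≤ k → (quadDiff S ^ k) p = 0 := fun k hk => hN k (by omega)
  rw [heat_eq_sum (N := N + 1) S (p := X j * p), sum_range_succ']
  · nth_rewrite 2 [heat_eq_sum S hN]
    rw [heat_eq_sum S hN1, sum_range_succ', map_sum, mul_add, mul_sum]
    simp only [quadDiff_pow_X_mul hS, smul_add, sum_add_distrib, map_smul, mul_smul_comm]
    have : ∀ k : ℕ, (((k + 1).factorial : ℂ)⁻¹) • ((k : ℂ) + 1) • linDiff S j ((quadDiff S ^ k) p) =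
        ((k.factorial : ℂ)⁻¹) • linDiff S j ((quadDiff S ^ k) p) := by
      intro k
      rw [smul_smul]
      congr 1
      rw [Nat.factorial_succ]
      have h1 : ((k : ℂ) + 1) ≠ 0 := Nat.cast_add_one_ne_zero k
      push_cast
      field_simp
    simp only [this]
    simp
    ring
  · intro k hk
    obtain ⟨k, rfl⟩ := Nat.exists_eq_add_of_le' (show 1 ≤ k by omega)
    rw [quadDiff_pow_X_mul hS, hN _ (by omega), hN _ (by omega)]
    simp

lemma pderiv_heat {S : Matrix ι ι ℂ} (hS : S.IsSymm) (i : ι) (p : MvPolynomial ι ℂ) :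
    pderiv i (heat S p) = heat S (pderiv i p) := by
  obtain ⟨N, hN⟩ := quadDiff_pow_eventually_zero hS p
  have h : ∀ k, pderiv i ((quadDiff S ^ k) p) = (quadDiff S ^ k) (pderiv i p) := by
    intro k
    induction k with
    | zero => simp
    | succ k ih => rw [pow_succ', Module.End.mul_apply, pderiv_quadDiff, ih]; rfl
  rw [heat_eq_sum S hN, heat_eq_sum (N := N) S, map_sum]
  · simp [h]
  · intro k hk
    rw [← h, hN k hk, map_zero]

/-- This is the recursion for the moments of a Gaussian with mean `c` and covariance `2S`. It is
purely formal: `S` is complex, and need not be definite. -/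
lemma eval_heat_X_mul {S : Matrix ι ι ℂ} (hS : S.IsSymm) (c : ι → ℂ) (j : ι)
    (p : MvPolynomial ι ℂ) :
    eval c (heat S (X j * p)) = c j * eval c (heat S p) +
      2 * ∑ k, S j k * eval c (heat S (pderiv k p)) := by
  rw [heat_X_mul hS, map_add, map_mul, eval_X, linDiff_apply, map_sum, mul_sum]
  simp only [smul_eval, pderiv_heat hS, mul_assoc]

/-- A linear functional satisfying the recursion of a Gaussian expectation is determined by its
value at `1`. -/
theorem functional_eq_eval_heat {S : Matrix ι ι ℂ} (hS : S.IsSymm) (c : ι → ℂ)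
    (φ : MvPolynomial ι ℂ →ₗ[ℂ] ℂ)
    (hφ : ∀ j p, φ (X j * p) = c j * φ p + 2 * ∑ k, S j k * φ (pderiv k p))
    (p : MvPolynomial ι ℂ) : φ p = φ 1 * eval c (heat S p) := by
  -- Induction on the degree: `hφ` reduces `X_j * t` to `t` and the derivatives of `t`. The bound is
  -- `≤ n` because those derivatives have varying degree; where the truncated subtraction of
  -- exponents loses nothing, the coefficient is zero.
  have key : ∀ (n : ℕ) (s : ι →₀ ℕ), s.degree ≤ n → ∀ a : ℂ,
      φ (monomial s a) = φ 1 * eval c (heat S (monomial s a)) := by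
    intro n
    induction n with
    | zero =>
      intro s hs a
      have : s = 0 := (Finsupp.degree_eq_zero_iff s).1 (Nat.le_zero.1 hs)
      subst this
      have h1 : (monomial 0 a : MvPolynomial ι ℂ) = a • 1 := by
        rw [smul_eq_C_mul, mul_one]; rfl
      rw [h1, map_smul, heat_smul hS, heat_one]
      simp [mul_comm]
    | succ n ih =>
      intro s hs a
      by_cases h0 : s = 0
      · exact ih s (by simp [h0]) a
      obtain ⟨j, hj⟩ : ∃ j, s j ≠ 0 := by
        by_contra h
        push Not at h
        exact h0 (Finsupp.ext h)
      obtain ⟨t, rfl⟩ : ∃ t, s = Finsupp.single j 1 + t := by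
        refine ⟨s - Finsupp.single j 1, ?_⟩
        rw [add_tsub_cancel_of_le]
        rw [Finsupp.single_le_iff]; omega
      have ht : t.degree ≤ n := by
        rw [map_add, Finsupp.degree_single] at hs; omega
      have hX : (monomial (Finsupp.single j 1 + t) a : MvPolynomial ι ℂ) = X j * monomial t a := by
        rw [X, monomial_mul, one_mul]
      rw [hX, hφ, eval_heat_X_mul hS, ih t ht]
      have : ∀ k, φ (pderiv k (monomial t a)) = φ 1 * eval c (heat S (pderiv k (monomial t a))) := by
        intro k
        rw [pderiv_monomial]
        refine ih _ (le_trans ?_ ht) _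
        exact Finsupp.degree_mono tsub_le_self
      simp only [this, mul_add, mul_sum]
      congr 1
      · ring
      · exact sum_congr rfl fun k _ => by ring
  induction p using MvPolynomial.induction_on' with
  | monomial s a => exact key _ s le_rfl a
  | add p q hp hq => rw [map_add, heat_add hS, map_add, hp, hq, mul_add]

/-- Evaluation at `c` as a linear functional. -/
def evalHom (c : ι → ℂ) : MvPolynomial ι ℂ →ₗ[ℂ] ℂ where
  toFun := eval c
  map_add' := by simp
  map_smul' := by simp [smul_eval]

omit [Fintype ι] in
lemma evalHom_apply (c : ι → ℂ) (p : MvPolynomial ι ℂ) : evalHom c p = eval c p := rfl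

/-- Covariances of independent Gaussians add: the composite functional obeys the recursion for `S +
S'`, which determines it. -/
lemma heat_heat {S S' : Matrix ι ι ℂ} (hS : S.IsSymm) (hS' : S'.IsSymm) (c : ι → ℂ)
    (p : MvPolynomial ι ℂ) : eval c (heat S (heat S' p)) = eval c (heat (S + S') p) := by
  have := functional_eq_eval_heat (hS.add hS') c
    (evalHom c ∘ₗ heatHom hS ∘ₗ heatHom hS') ?_ p
  · simpa [heatHom_apply, heat_one, evalHom_apply] using this
  · intro j p
    simp only [LinearMap.comp_apply, heatHom_apply, evalHom_apply]
    rw [heat_X_mul hS', heat_add hS, map_add, eval_heat_X_mul hS, linDiff_apply,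
      ← heatHom_apply hS (∑ k, _), map_sum, map_sum, add_assoc, mul_sum, mul_sum,
      ← sum_add_distrib]
    congr 1
    refine sum_congr rfl fun k _ => ?_
    rw [map_smul, heatHom_apply, smul_eval, pderiv_heat hS', Matrix.add_apply]
    ring

/-- The polynomial `x ↦ p (L x)`. -/
def linComp (L : Matrix ι ι ℂ) : MvPolynomial ι ℂ →ₐ[ℂ] MvPolynomial ι ℂ :=
  aeval fun j => ∑ a, L j a • X a

lemma eval_linComp (L : Matrix ι ι ℂ) (x : ι → ℂ) (p : MvPolynomial ι ℂ) :
    eval x (linComp L p) = eval (L.mulVec x) p := by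
  induction p using MvPolynomial.induction_on with
  | C a => simp [linComp]
  | add p q hp hq => simp [hp, hq]
  | mul_X p j hp =>
    rw [map_mul, map_mul, hp, map_mul, eval_X]
    simp [linComp, smul_eval, Matrix.mulVec, dotProduct]

lemma pderiv_linComp (L : Matrix ι ι ℂ) (k : ι) (p : MvPolynomial ι ℂ) :
    pderiv k (linComp L p) = ∑ b, L b k • linComp L (pderiv b p) := by
  classical
  induction p using MvPolynomial.induction_on with
  | C a => simp [linComp]
  | add p q hp hq => simp [hp, hq, sum_add_distrib]
  | mul_X p j hp =>
    have h1 : pderiv k (linComp L (X j)) = C (L j k) := by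
      simp [linComp, pderiv_X, Pi.single_apply, smul_eq_C_mul]
    have h2 : ∀ b, linComp L (pderiv b (p * X j)) =
        linComp L (X j) * linComp L (pderiv b p) + (if j = b then linComp L p else 0) := by
      intro b
      rw [Derivation.leibniz, pderiv_X, Pi.single_apply]
      split_ifs <;> simp [add_comm]
    have h3 : ∀ b, L b k • linComp L (pderiv b (p * X j)) =
        linComp L (X j) * (L b k • linComp L (pderiv b p)) +
          (if j = b then L b k • linComp L p else 0) := by
      intro b
      rw [h2, smul_add, mul_smul_comm]
      split_ifs <;> simp
    simp only [h3, sum_add_distrib, ← mul_sum, ← hp, sum_ite_eq, mem_univ, if_true]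
    rw [map_mul, Derivation.leibniz, h1, add_comm, smul_eq_mul, smul_eq_mul, smul_eq_C_mul,
      mul_comm (C _)]

/-- A linear image of a Gaussian has mean `L c` and covariance transformed by `L · Lᵀ`; the chain
rule shows that the left side obeys the corresponding recursion. -/
lemma heat_linComp {S L : Matrix ι ι ℂ} (hS : S.IsSymm) (c : ι → ℂ) (p : MvPolynomial ι ℂ) :
    eval c (heat S (linComp L p)) = eval (L.mulVec c) (heat (L * S * L.transpose) p) := by
  have hS' : (L * S * L.transpose).IsSymm := by
    rw [Matrix.IsSymm, Matrix.transpose_mul, Matrix.transpose_mul, Matrix.transpose_transpose,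
      hS.eq, Matrix.mul_assoc]
  have := functional_eq_eval_heat hS' (L.mulVec c)
    (evalHom c ∘ₗ heatHom hS ∘ₗ (linComp L).toLinearMap) ?_ p
  · simpa [heatHom_apply, heat_one, evalHom_apply] using this
  · intro j p
    simp only [LinearMap.comp_apply, heatHom_apply, evalHom_apply,
      AlgHom.toLinearMap_apply]
    have h1 : linComp L (X j * p) = ∑ a, L j a • (X a * linComp L p) := by
      rw [map_mul]
      simp [linComp, sum_mul]
    rw [h1, ← heatHom_apply hS, map_sum, map_sum]
    simp only [map_smul, heatHom_apply, smul_eval, eval_heat_X_mul hS, pderiv_linComp]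
    simp only [← heatHom_apply hS, map_sum, map_smul, smul_eval]
    simp only [mul_add, sum_add_distrib]
    congr 1
    · simp only [Matrix.mulVec, dotProduct, sum_mul, mul_assoc]
    · simp only [Matrix.mul_apply, Matrix.transpose_apply, mul_sum, sum_mul]
      conv_rhs => rw [sum_comm]
      conv_lhs => rw [sum_comm]
      refine sum_congr rfl fun a _ => ?_
      rw [sum_comm]
      refine sum_congr rfl fun b _ => sum_congr rfl fun d _ => ?_
      ring

end Heat

open MvPolynomial Finset MeasureTheory Filter Topology

/-! ### Bounds for polynomials times Gaussians, uniform in the quadratic form -/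

section Decay

variable {ι : Type*} [Fintype ι]

/-- The product weight `∏ (1 + x_i²)⁻¹`, which is integrable and summable over lattices. -/
def decay (x : ι → ℝ) : ℝ := ∏ i, (1 + x i ^ 2)⁻¹

lemma decay_nonneg (x : ι → ℝ) : 0 ≤ decay x := prod_nonneg fun i _ => by positivity

/-- A shift costs a factor that depends on the shift only; coordinatewise this is `1 + x² ≤ 2 (1 +
y²)(1 + (y + x)²)`. -/
lemma decay_add_le (y x : ι → ℝ) :
    decay (y + x) ≤ (∏ i, (2 * (1 + y i ^ 2))) * decay x := by
  rw [decay, decay, ← prod_mul_distrib]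
  refine prod_le_prod (fun i _ => by positivity) fun i _ => ?_
  rw [Pi.add_apply, inv_le_iff_one_le_mul₀ (by positivity), mul_right_comm, ← div_eq_mul_inv,
    one_le_div (by positivity)]
  nlinarith [sq_nonneg (2 * y i + x i), sq_nonneg (y i * (y i + x i)), sq_nonneg (y i + x i)]

lemma summable_int_inv_one_add_sq : Summable fun n : ℤ => (1 + (n : ℝ) ^ 2)⁻¹ := by
  have h : Summable fun n : ℕ => (1 + (n : ℝ) ^ 2)⁻¹ := by
    have h1 : Summable fun n : ℕ => 2 * (((n + 1 : ℕ) : ℝ) ^ 2)⁻¹ :=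
      (((summable_nat_add_iff 1).2 (Real.summable_nat_pow_inv.2 one_lt_two))).mul_left 2
    refine Summable.of_nonneg_of_le (fun n => by positivity) (fun n => ?_) h1
    rw [← div_eq_mul_inv, inv_eq_one_div, div_le_div_iff₀ (by positivity) (by positivity)]
    push_cast
    nlinarith [sq_nonneg ((n : ℝ) - 1)]
  refine summable_int_iff_summable_nat_and_neg.2 ⟨by simpa using h, by simpa using h⟩

/-- A finite set of lattice points lies in a box, and over a box the sum is a product of
one-dimensional sums. -/
lemma summable_decay_int : Summable fun R : ι → ℤ => decay fun i => (R i : ℝ) := by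
  classical
  refine summable_of_sum_le (c := ∏ _i : ι, ∑' n : ℤ, (1 + (n : ℝ) ^ 2)⁻¹)
    (fun R => decay_nonneg _) fun s => ?_
  let t : ι → Finset ℤ := fun i => s.image fun R => R i
  calc ∑ R ∈ s, decay (fun i => (R i : ℝ))
      ≤ ∑ R ∈ Fintype.piFinset t, decay (fun i => (R i : ℝ)) := by
        refine sum_le_sum_of_subset_of_nonneg (fun R hR => ?_) fun R _ _ => decay_nonneg _
        rw [Fintype.mem_piFinset]
        exact fun i => mem_image_of_mem _ hR
    _ = ∏ i, ∑ n ∈ t i, (1 + (n : ℝ) ^ 2)⁻¹ := by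
        rw [prod_univ_sum]; rfl
    _ ≤ _ := by
        refine prod_le_prod (fun i _ => sum_nonneg fun n _ => by positivity) fun i _ => ?_
        exact summable_int_inv_one_add_sq.sum_le_tsum _ fun n _ => by positivity

lemma summable_decay (h : ι → ℝ) : Summable fun R : ι → ℤ => decay (h + fun i => (R i : ℝ)) :=
  Summable.of_nonneg_of_le (fun _ => decay_nonneg _) (fun _ => decay_add_le _ _)
    (summable_decay_int.mul_left _)

lemma integrable_decay : Integrable (decay : (ι → ℝ) → ℝ) :=
  Integrable.fintype_prod (f := fun _ x => (1 + x ^ 2)⁻¹) fun _ => integrable_inv_one_add_sq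

lemma exists_pow_mul_exp_le (k : ℕ) {ε : ℝ} (hε : 0 < ε) :
    ∃ C : ℝ, 0 ≤ C ∧ ∀ x : ℝ, |x| ^ k * Real.exp (-ε * x ^ 2) ≤ C * (1 + x ^ 2)⁻¹ := by
  -- The constant comes from `t^(k+1)/(k+1)! ≤ exp t` at `t = ε(1 + x²)`; the factor `exp ε` pays
  -- for the summand `1` in `1 + x²`.
  refine ⟨(k + 1).factorial * (max 1 ε⁻¹) ^ (k + 1) * Real.exp ε, by positivity, fun x => ?_⟩
  rw [← div_eq_mul_inv, le_div_iff₀ (by positivity)]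
  have h0 : (1 : ℝ) ≤ 1 + x ^ 2 := by nlinarith [sq_nonneg x]
  have h1 : |x| ^ k ≤ (1 + x ^ 2) ^ k := by
    refine pow_le_pow_left₀ (abs_nonneg _) ?_ _
    nlinarith [sq_nonneg (|x| - 1), sq_abs x]
  have h2 : (ε * (1 + x ^ 2)) ^ (k + 1) / (k + 1).factorial ≤ Real.exp (ε * (1 + x ^ 2)) :=
    Real.pow_div_factorial_le_exp _ (by positivity) _
  have h3 : (1 + x ^ 2) ≤ max 1 ε⁻¹ * (ε * (1 + x ^ 2)) := by
    calc (1 + x ^ 2) = ε⁻¹ * (ε * (1 + x ^ 2)) := by field_simp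
      _ ≤ _ := mul_le_mul_of_nonneg_right (le_max_right _ _) (by positivity)
  have h4 : (1 + x ^ 2) ^ (k + 1) ≤
      (k + 1).factorial * (max 1 ε⁻¹) ^ (k + 1) * Real.exp (ε * (1 + x ^ 2)) := by
    rw [div_le_iff₀ (by positivity)] at h2
    calc (1 + x ^ 2) ^ (k + 1) ≤ (max 1 ε⁻¹ * (ε * (1 + x ^ 2))) ^ (k + 1) :=
          pow_le_pow_left₀ (by positivity) h3 _
      _ = (max 1 ε⁻¹) ^ (k + 1) * (ε * (1 + x ^ 2)) ^ (k + 1) := mul_pow _ _ _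
      _ ≤ (max 1 ε⁻¹) ^ (k + 1) * (Real.exp (ε * (1 + x ^ 2)) * (k + 1).factorial) := by gcongr
      _ = _ := by ring
  calc |x| ^ k * Real.exp (-ε * x ^ 2) * (1 + x ^ 2)
      ≤ (1 + x ^ 2) ^ k * Real.exp (-ε * x ^ 2) * (1 + x ^ 2) := by gcongr
    _ = (1 + x ^ 2) ^ (k + 1) * Real.exp (-ε * x ^ 2) := by ring
    _ ≤ (k + 1).factorial * (max 1 ε⁻¹) ^ (k + 1) * Real.exp (ε * (1 + x ^ 2)) *
        Real.exp (-ε * x ^ 2) := by gcongr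
    _ = _ := by rw [mul_assoc, ← Real.exp_add]; congr 2; ring

/-- The value of a complex polynomial at a real point. -/
def evalR (p : MvPolynomial ι ℂ) (x : ι → ℝ) : ℂ := eval (fun i => (x i : ℂ)) p

lemma exists_norm_evalR_mul_exp_le (p : MvPolynomial ι ℂ) {ε : ℝ} (hε : 0 < ε) :
    ∃ C : ℝ, 0 ≤ C ∧ ∀ x : ι → ℝ,
      ‖evalR p x‖ * Real.exp (-ε * ∑ i, x i ^ 2) ≤ C * decay x := by
  induction p using MvPolynomial.induction_on' with
  | monomial s a =>
    choose C hC0 hC using fun k => exists_pow_mul_exp_le k hε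
    refine ⟨‖a‖ * ∏ i, C (s i), mul_nonneg (norm_nonneg _) (prod_nonneg fun i _ => hC0 _),
      fun x => ?_⟩
    rw [evalR, eval_monomial, Finsupp.prod_fintype _ _ (by simp), norm_mul, norm_prod, mul_sum,
      Real.exp_sum, mul_assoc, mul_assoc, ← prod_mul_distrib, decay, ← prod_mul_distrib]
    refine mul_le_mul_of_nonneg_left ?_ (norm_nonneg _)
    refine prod_le_prod (fun i _ => by positivity) fun i _ => ?_
    simpa using hC (s i) (x i)
  | add p q hp hq =>
    obtain ⟨C, hC0, hC⟩ := hp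
    obtain ⟨D, hD0, hD⟩ := hq
    refine ⟨C + D, by positivity, fun x => ?_⟩
    calc ‖evalR (p + q) x‖ * Real.exp (-ε * ∑ i, x i ^ 2)
        ≤ (‖evalR p x‖ + ‖evalR q x‖) * Real.exp (-ε * ∑ i, x i ^ 2) := by
          refine mul_le_mul_of_nonneg_right ?_ (Real.exp_nonneg _)
          rw [evalR, map_add]
          exact norm_add_le _ _
      _ ≤ _ := by
          rw [add_mul, add_mul]
          exact add_le_add (hC x) (hD x)

omit [Fintype ι] in
lemma continuous_evalR (p : MvPolynomial ι ℂ) : Continuous (evalR p) :=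
  (MvPolynomial.continuous_eval p).comp (by fun_prop)

/-- The quadratic form `xᵀ B x` of a complex matrix at a real point. -/
def quadForm (B : Matrix ι ι ℂ) (x : ι → ℝ) : ℂ := ∑ i, ∑ j, B i j * (x i * x j)

lemma continuous_quadForm_uncurry :
    Continuous fun q : Matrix ι ι ℂ × (ι → ℝ) => quadForm q.1 q.2 := by
  unfold quadForm
  fun_prop

lemma quadForm_smul (B : Matrix ι ι ℂ) (t : ℝ) (x : ι → ℝ) :
    quadForm B (t • x) = t ^ 2 * quadForm B x := by
  simp only [quadForm, mul_sum, Pi.smul_apply, smul_eq_mul, Complex.ofReal_mul]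
  exact sum_congr rfl fun i _ => sum_congr rfl fun j _ => by ring

/-- The real part of `B` is a positive definite quadratic form. -/
def IsCoercive (B : Matrix ι ι ℂ) : Prop := ∀ x : ι → ℝ, x ≠ 0 → 0 < (quadForm B x).re

/-- On the compact unit sphere the real part of the form has a positive lower bound, and compactness
keeps a smaller bound for all nearby forms at once. Homogeneity extends it to all vectors. -/
lemma IsCoercive.exists_eventually {B : Matrix ι ι ℂ} (hB : IsCoercive B) :
    ∃ ε : ℝ, 0 < ε ∧ ∀ᶠ B' in 𝓝 B, ∀ x : ι → ℝ, ε * ∑ i, x i ^ 2 ≤ (quadForm B' x).re := by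
  let K : Set (ι → ℝ) := {x | ∑ i, x i ^ 2 = 1}
  have hK : IsCompact K := by
    refine Metric.isCompact_of_isClosed_isBounded (isClosed_eq (by fun_prop) continuous_const) ?_
    refine (Metric.isBounded_closedBall (x := (0 : ι → ℝ)) (r := 1)).subset fun x hx => ?_
    rw [mem_closedBall_zero_iff, pi_norm_le_iff_of_nonneg zero_le_one]
    intro i
    rw [Real.norm_eq_abs, abs_le_one_iff_mul_self_le_one, ← sq]
    have : ∑ i, x i ^ 2 = 1 := hx
    rw [← this]
    exact single_le_sum (f := fun i => x i ^ 2) (fun i _ => sq_nonneg _) (mem_univ i)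
  obtain ⟨ε, hε, hmin⟩ : ∃ ε : ℝ, 0 < ε ∧ ∀ x ∈ K, ε < (quadForm B x).re := by
    have hc : ContinuousOn (fun x => (quadForm B x).re) K :=
      (Complex.continuous_re.comp
        (continuous_quadForm_uncurry.comp (Continuous.prodMk_right B))).continuousOn
    rcases K.eq_empty_or_nonempty with h | h
    -- The sphere is empty when `ι` is.
    · exact ⟨1, one_pos, by simp [h]⟩
    · obtain ⟨x, hx, hm⟩ := hK.exists_isMinOn h hc
      have hx0 : x ≠ 0 := by
        rintro rfl
        have : ∑ i : ι, (0 : ι → ℝ) i ^ 2 = 1 := hx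
        simp at this
      refine ⟨(quadForm B x).re / 2, half_pos (hB x hx0), fun y hy => ?_⟩
      exact lt_of_lt_of_le (half_lt_self (hB x hx0)) (hm hy)
  refine ⟨ε, hε, ?_⟩
  have : ∀ᶠ B' in 𝓝 B, ∀ x ∈ K, ε < (quadForm B' x).re := by
    refine hK.eventually_forall_of_forall_eventually fun x hx => ?_
    exact (Complex.continuous_re.comp continuous_quadForm_uncurry).continuousAt.eventually
      (lt_mem_nhds (hmin x hx))
  filter_upwards [this] with B' hB' x
  have hs : 0 ≤ ∑ i, x i ^ 2 := sum_nonneg fun i _ => sq_nonneg _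
  rcases hs.eq_or_lt with h | h
  · have hx : x = 0 := by
      funext i
      have := (sum_eq_zero_iff_of_nonneg fun i _ => sq_nonneg (x i)).1 h.symm i (mem_univ i)
      simpa using this
    subst hx
    simp [quadForm]
  · set t := Real.sqrt (∑ i, x i ^ 2) with ht
    have ht0 : 0 < t := Real.sqrt_pos.2 h
    have ht2 : t ^ 2 = ∑ i, x i ^ 2 := Real.sq_sqrt hs
    have hm : t⁻¹ • x ∈ K := by
      change ∑ i, (t⁻¹ • x) i ^ 2 = 1
      simp only [Pi.smul_apply, smul_eq_mul, mul_pow, ← mul_sum]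
      rw [← ht2, ← mul_pow, inv_mul_cancel₀ ht0.ne', one_pow]
    have h1 : quadForm B' x = ((t ^ 2 : ℝ) : ℂ) * quadForm B' (t⁻¹ • x) := by
      rw [quadForm_smul]
      push_cast
      have : (t : ℂ) ≠ 0 := by exact_mod_cast ht0.ne'
      field_simp
    rw [h1, Complex.re_ofReal_mul, ← ht2, mul_comm ε]
    exact mul_le_mul_of_nonneg_left (hB' _ hm).le (sq_nonneg _)

/-- The Gaussian `exp(-π xᵀ B x + 2πi v·x)`. -/
def gaussian (B : Matrix ι ι ℂ) (v x : ι → ℝ) : ℂ :=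
  Complex.exp (-Real.pi * quadForm B x + 2 * Real.pi * Complex.I * ∑ i, (v i : ℂ) * x i)

/-- The frequency `v` is real, so the linear term is only a phase and all bounds are uniform in `v`.
-/
lemma norm_gaussian (B : Matrix ι ι ℂ) (v x : ι → ℝ) :
    ‖gaussian B v x‖ = Real.exp (-Real.pi * (quadForm B x).re) := by
  have h : 2 * (Real.pi : ℂ) * Complex.I * ∑ i, (v i : ℂ) * x i =
      ((2 * Real.pi * ∑ i, v i * x i : ℝ) : ℂ) * Complex.I := by
    push_cast; ring
  rw [gaussian, Complex.norm_exp, h]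
  congr 1
  rw [Complex.add_re, Complex.re_ofReal_mul, Complex.I_re, mul_zero, add_zero,
    ← Complex.ofReal_neg, Complex.re_ofReal_mul]

lemma continuous_gaussian (B : Matrix ι ι ℂ) (v : ι → ℝ) : Continuous (gaussian B v) := by
  unfold gaussian quadForm
  fun_prop

/-- A bound for polynomials times Gaussians which is locally uniform in the quadratic form. -/
lemma IsCoercive.exists_eventually_norm_le {B : Matrix ι ι ℂ} (hB : IsCoercive B)
    (p : MvPolynomial ι ℂ) : ∃ C : ℝ, 0 ≤ C ∧ ∀ᶠ B' in 𝓝 B, ∀ v x : ι → ℝ,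
      ‖evalR p x * gaussian B' v x‖ ≤ C * decay x := by
  obtain ⟨ε, hε, h⟩ := hB.exists_eventually
  obtain ⟨C, hC0, hC⟩ := exists_norm_evalR_mul_exp_le p (mul_pos Real.pi_pos hε)
  refine ⟨C, hC0, ?_⟩
  filter_upwards [h] with B' hB' v x
  refine le_trans ?_ (hC x)
  rw [norm_mul, norm_gaussian]
  refine mul_le_mul_of_nonneg_left (Real.exp_le_exp.2 ?_) (norm_nonneg _)
  have := mul_le_mul_of_nonneg_left (hB' x) Real.pi_pos.le
  linarith

lemma IsCoercive.exists_norm_le {B : Matrix ι ι ℂ} (hB : IsCoercive B) (p : MvPolynomial ι ℂ) :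
    ∃ C : ℝ, 0 ≤ C ∧ ∀ v x : ι → ℝ, ‖evalR p x * gaussian B v x‖ ≤ C * decay x := by
  obtain ⟨C, hC0, h⟩ := hB.exists_eventually_norm_le p
  exact ⟨C, hC0, h.self_of_nhds⟩

lemma IsCoercive.summable {B : Matrix ι ι ℂ} (hB : IsCoercive B) (p : MvPolynomial ι ℂ)
    (v h : ι → ℝ) : Summable fun R : ι → ℤ =>
      evalR p (h + fun i => (R i : ℝ)) * gaussian B v (h + fun i => (R i : ℝ)) := by
  obtain ⟨C, _, hC⟩ := hB.exists_norm_le p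
  exact Summable.of_norm_bounded ((summable_decay h).mul_left C) fun R => hC _ _

lemma IsCoercive.integrable {B : Matrix ι ι ℂ} (hB : IsCoercive B) (p : MvPolynomial ι ℂ)
    (v : ι → ℝ) : Integrable fun x => evalR p x * gaussian B v x := by
  obtain ⟨C, _, hC⟩ := hB.exists_norm_le p
  refine (integrable_decay.const_mul C).mono'
    ((continuous_evalR p).mul (continuous_gaussian B v)).aestronglyMeasurable ?_
  exact Eventually.of_forall fun x => hC _ _

end Decay

open MvPolynomial Finset MeasureTheory Filter Topology

/-! ### Gaussian integrals of polynomials -/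

section GaussianIntegral

variable {ι : Type*} [Fintype ι]

omit [Fintype ι] in
lemma hasLineDerivAt_evalR [DecidableEq ι] (p : MvPolynomial ι ℂ) (x : ι → ℝ) (k : ι) :
    HasLineDerivAt ℝ (evalR p) (evalR (pderiv k p) x) x (Pi.single k 1) := by
  unfold HasLineDerivAt
  induction p using MvPolynomial.induction_on with
  | C a => simpa [evalR] using hasDerivAt_const (0 : ℝ) a
  | add p q hp hq =>
    convert! hp.add hq using 1
    · funext t
      simp [evalR]
    · simp [evalR]
  | mul_X p j hp =>
    have hj : HasDerivAt (fun t : ℝ => (((x + t • (Pi.single k 1 : ι → ℝ)) j : ℝ) : ℂ))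
        (((Pi.single k (1 : ℝ) : ι → ℝ) j : ℝ) : ℂ) 0 := by
      have h1 : HasDerivAt (fun t : ℝ => (x + t • (Pi.single k 1 : ι → ℝ)) j)
          ((Pi.single k (1 : ℝ) : ι → ℝ) j) 0 := by
        simpa using ((hasDerivAt_id (0 : ℝ)).mul_const
          ((Pi.single k (1 : ℝ) : ι → ℝ) j)).const_add (x j)
      exact h1.ofReal_comp
    have h := hp.mul hj
    convert! h using 1
    · funext t
      simp [evalR]
    · simp only [evalR, Derivation.leibniz, pderiv_X, zero_smul, add_zero]
      rcases eq_or_ne k j with rfl | hkj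
      · simp [mul_comm, add_comm]
      · simp [hkj.symm, mul_comm]

lemma quadForm_eq_evalR (B : Matrix ι ι ℂ) (x : ι → ℝ) :
    quadForm B x = evalR (∑ i, ∑ j, C (B i j) * (X i * X j)) x := by
  simp [quadForm, evalR]

omit [Fintype ι] in
lemma evalR_X_mul (p : MvPolynomial ι ℂ) (j : ι) (x : ι → ℝ) :
    evalR (X j * p) x = x j * evalR p x := by
  simp [evalR]

lemma hasLineDerivAt_quadForm [DecidableEq ι] {B : Matrix ι ι ℂ} (hB : B.IsSymm) (x : ι → ℝ)
    (k : ι) :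
    HasLineDerivAt ℝ (quadForm B) (2 * ∑ j, B k j * x j) x (Pi.single k 1) := by
  have h := hasLineDerivAt_evalR (∑ i, ∑ j, C (B i j) * (X i * X j)) x k
  have h2 : quadForm B = evalR (∑ i, ∑ j, C (B i j) * (X i * X j)) :=
    funext (quadForm_eq_evalR B)
  rw [h2]
  convert! h using 1
  have h1 : ∀ i j, pderiv k (C (B i j) * (X i * X j)) =
      (if i = k then C (B i j) * X j else 0) + (if j = k then C (B i j) * X i else 0) := by
    intro i j
    simp only [Derivation.leibniz, pderiv_C, pderiv_X, Pi.single_apply, smul_eq_mul]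
    split_ifs <;> ring
  simp only [map_sum, h1, sum_add_distrib]
  have e1 : ∑ i, ∑ j, (if i = k then C (B i j) * X j else 0 : MvPolynomial ι ℂ) =
      ∑ j, C (B k j) * X j := by
    rw [sum_comm]; simp
  have e2 : ∑ i, ∑ j, (if j = k then C (B i j) * X i else 0 : MvPolynomial ι ℂ) =
      ∑ j, C (B k j) * X j := by
    simp only [sum_ite_eq', mem_univ, if_true]
    exact sum_congr rfl fun i _ => by rw [hB.apply]
  rw [e1, e2, two_mul]
  simp [evalR]

lemma hasLineDerivAt_gaussian [DecidableEq ι] {B : Matrix ι ι ℂ} (hB : B.IsSymm) (v x : ι → ℝ)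
    (k : ι) :
    HasLineDerivAt ℝ (gaussian B v) ((-Real.pi * (2 * ∑ j, B k j * x j) +
      2 * Real.pi * Complex.I * v k) * gaussian B v x) x (Pi.single k 1) := by
  have h1 := hasLineDerivAt_quadForm hB x k
  have h2 := hasLineDerivAt_evalR (∑ i, C (v i : ℂ) * X i) x k
  have h3 : pderiv k (∑ i, C (v i : ℂ) * X i) = C (v k : ℂ) := by
    simp [pderiv_X, Pi.single_apply]
  rw [h3] at h2
  unfold HasLineDerivAt at h1 h2 ⊢
  have h4 := ((h1.const_mul (-Real.pi : ℂ)).add (h2.const_mul (2 * Real.pi * Complex.I))).cexp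
  convert! h4 using 1
  · funext t
    simp [gaussian, evalR]
  · simp [gaussian, evalR]
    ring

/-- Integration of a polynomial against a Gaussian, as a linear functional. -/
def gaussianFunctional {B : Matrix ι ι ℂ} (hB : IsCoercive B) (v : ι → ℝ) :
    MvPolynomial ι ℂ →ₗ[ℂ] ℂ where
  toFun p := ∫ x, evalR p x * gaussian B v x
  map_add' p q := by
    rw [← integral_add (hB.integrable p v) (hB.integrable q v)]
    congr 1; funext x; simp [evalR, add_mul]
  map_smul' c p := by
    rw [RingHom.id_apply, smul_eq_mul, ← integral_const_mul]
    congr 1; funext x; simp [evalR, smul_eval, mul_assoc]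

lemma gaussianFunctional_apply {B : Matrix ι ι ℂ} (hB : IsCoercive B) (v : ι → ℝ)
    (p : MvPolynomial ι ℂ) :
    gaussianFunctional hB v p = ∫ x, evalR p x * gaussian B v x := rfl

/-- Integration by parts in the direction `k`: the logarithmic derivative of the Gaussian is `-2π
(Bx)_k + 2πi v_k`, and decay leaves no boundary term. -/
lemma gaussianFunctional_pderiv {B : Matrix ι ι ℂ} (hB : IsCoercive B) (hs : B.IsSymm)
    (v : ι → ℝ) (p : MvPolynomial ι ℂ) (k : ι) :
    2 * Real.pi * ∑ j, B k j * gaussianFunctional hB v (X j * p) =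
      2 * Real.pi * Complex.I * v k * gaussianFunctional hB v p +
        gaussianFunctional hB v (pderiv k p) := by
  classical
  have hfun : ∀ x, evalR p x * ((-Real.pi * (2 * ∑ j, B k j * x j) +
      2 * Real.pi * Complex.I * v k) * gaussian B v x) =
      evalR (C (-(2 * Real.pi) : ℂ) * (∑ j, C (B k j) * (X j * p)) +
        C (2 * Real.pi * Complex.I * v k) * p) x * gaussian B v x := by
    intro x
    simp only [evalR, map_add, map_mul, map_sum, eval_C, eval_X, ← mul_assoc, ← sum_mul]
    ring
  have hint : Integrable fun x => ContinuousLinearMap.mul ℝ ℂ (evalR p x)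
      ((-Real.pi * (2 * ∑ j, B k j * x j) + 2 * Real.pi * Complex.I * v k) * gaussian B v x) := by
    simp only [ContinuousLinearMap.mul_apply', hfun]
    exact hB.integrable _ v
  have h := integral_bilinear_hasLineDerivAt_right_eq_neg_left_of_integrable
    (μ := (volume : Measure (ι → ℝ))) (B := ContinuousLinearMap.mul ℝ ℂ)
    (f := evalR p) (f' := evalR (pderiv k p)) (g := gaussian B v)
    (g' := fun x => (-Real.pi * (2 * ∑ j, B k j * x j) +
      2 * Real.pi * Complex.I * v k) * gaussian B v x) (v := Pi.single k 1)
    (hB.integrable _ v) hint (hB.integrable _ v)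
    (fun x _ => hasLineDerivAt_evalR p x k) (fun x _ => hasLineDerivAt_gaussian hs v x k)
  simp only [ContinuousLinearMap.mul_apply', hfun, ← gaussianFunctional_apply hB] at h
  simp only [C_mul', map_add, map_smul, map_sum, smul_eq_mul] at h
  linear_combination -h

variable [DecidableEq ι]

/-- Solving the integration by parts relations for the moments of `X_j p` by means of `B⁻¹` gives
the recursion of `functional_eq_eval_heat` with `c = i B⁻¹ v` and `S = B⁻¹ / 4π`. -/
theorem gaussianFunctional_eq {B : Matrix ι ι ℂ} (hB : IsCoercive B) (hs : B.IsSymm)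
    (hdet : IsUnit B.det) (v : ι → ℝ) (p : MvPolynomial ι ℂ) :
    gaussianFunctional hB v p = (∫ x, gaussian B v x) *
      eval (fun j => Complex.I * B⁻¹.mulVec (fun k => (v k : ℂ)) j)
        (heat ((4 * Real.pi : ℂ)⁻¹ • B⁻¹) p) := by
  have hs' : ((4 * Real.pi : ℂ)⁻¹ • B⁻¹).IsSymm := by
    rw [Matrix.IsSymm, Matrix.transpose_smul, Matrix.transpose_nonsing_inv, hs.eq]
  have hpi : (Real.pi : ℂ) ≠ 0 := by exact_mod_cast Real.pi_ne_zero
  rw [functional_eq_eval_heat hs' (fun j => Complex.I * B⁻¹.mulVec (fun k => (v k : ℂ)) j)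
    (gaussianFunctional hB v)]
  · congr 1
    simp [gaussianFunctional_apply, evalR]
  · intro j p
    have h1 : gaussianFunctional hB v (X j * p) =
        B⁻¹.mulVec (B.mulVec fun i => gaussianFunctional hB v (X i * p)) j := by
      rw [Matrix.mulVec_mulVec, Matrix.nonsing_inv_mul _ hdet, Matrix.one_mulVec]
    have h2 : ∀ k, B.mulVec (fun i => gaussianFunctional hB v (X i * p)) k =
        Complex.I * v k * gaussianFunctional hB v p +
          (2 * (Real.pi : ℂ))⁻¹ * gaussianFunctional hB v (pderiv k p) := by
      intro k
      have := gaussianFunctional_pderiv hB hs v p k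
      simp only [Matrix.mulVec, dotProduct]
      field_simp
      linear_combination this
    rw [h1]
    simp only [Matrix.mulVec, dotProduct] at h2 ⊢
    simp only [h2, mul_add, sum_add_distrib, mul_sum, sum_mul, Matrix.smul_apply, smul_eq_mul]
    congr 1
    · exact sum_congr rfl fun k _ => by ring
    · refine sum_congr rfl fun k _ => ?_
      field_simp
      ring

/-- Write `R = NᵀN`; the congruence by `N⁻¹` takes `R` to `1`, and an orthogonal eigenbasis of the
transformed `S` keeps it there. -/
lemma exists_real_diagonalization {R S : Matrix ι ι ℝ} (hR : R.PosDef) (hS : S.IsSymm) :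
    ∃ (G : Matrix ι ι ℝ) (d : ι → ℝ), G.det ≠ 0 ∧ G.transpose * R * G = 1 ∧
      G.transpose * S * G = Matrix.diagonal d := by
  obtain ⟨N, hN⟩ := CStarAlgebra.nonneg_iff_eq_star_mul_self.mp hR.posSemidef.nonneg
  have hN' : R = N.transpose * N := by rw [hN, Matrix.star_eq_conjTranspose]; simp
  have hdet : IsUnit N.det := by
    have := hR.det_pos
    rw [hN', Matrix.det_mul, Matrix.det_transpose] at this
    exact isUnit_iff_ne_zero.2 fun h => by simp [h] at this
  set Q := N⁻¹ with hQ
  have hNQ : N * Q = 1 := Matrix.mul_nonsing_inv _ hdet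
  have hM : (Q.transpose * S * Q).IsHermitian := by
    rw [Matrix.IsHermitian, Matrix.conjTranspose_eq_transpose_of_trivial]
    simp [Matrix.transpose_mul, hS.eq, Matrix.mul_assoc]
  set V : Matrix ι ι ℝ := (hM.eigenvectorUnitary : Matrix ι ι ℝ) with hV
  have hVV : V.transpose * V = 1 := by
    have := Unitary.coe_star_mul_self hM.eigenvectorUnitary
    rwa [Matrix.star_eq_conjTranspose, Matrix.conjTranspose_eq_transpose_of_trivial] at this
  have hdiag := hM.conjStarAlgAut_star_eigenvectorUnitary
  rw [Unitary.conjStarAlgAut_star_apply, Matrix.star_eq_conjTranspose,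
    Matrix.conjTranspose_eq_transpose_of_trivial] at hdiag
  refine ⟨Q * V, hM.eigenvalues, ?_, ?_, ?_⟩
  · rw [Matrix.det_mul]
    refine mul_ne_zero ?_ ?_
    · intro h
      have := congrArg Matrix.det hNQ
      simp [h] at this
    · intro h
      have := congrArg Matrix.det hVV
      simp [h] at this
  · calc (Q * V).transpose * R * (Q * V)
        = V.transpose * ((N * Q).transpose * (N * Q)) * V := by
          rw [hN']; simp only [Matrix.transpose_mul, Matrix.mul_assoc]
      _ = 1 := by rw [hNQ]; simp [hVV]
  · calc (Q * V).transpose * S * (Q * V) = V.transpose * (Q.transpose * S * Q) * V := by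
          simp only [Matrix.transpose_mul, Matrix.mul_assoc]
      _ = _ := hdiag

omit [DecidableEq ι] in
lemma quadForm_eq_dotProduct (B : Matrix ι ι ℂ) (x : ι → ℝ) :
    quadForm B x = dotProduct (fun i => (x i : ℂ)) (B.mulVec fun i => (x i : ℂ)) := by
  simp only [quadForm, dotProduct, Matrix.mulVec, mul_sum]
  exact sum_congr rfl fun i _ => sum_congr rfl fun j _ => by ring

/-- The real and imaginary parts of `B` are diagonalized together, the real part to `1`. Since `G`
is real, it is an admissible change of variables in the integral. -/
lemma IsCoercive.exists_diagonalization {B : Matrix ι ι ℂ} (hB : IsCoercive B) (hs : B.IsSymm) :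
    ∃ (G : Matrix ι ι ℝ) (d : ι → ℂ), G.det ≠ 0 ∧ (∀ i, 0 < (d i).re) ∧
      (G.map Complex.ofRealHom).transpose * B * G.map Complex.ofRealHom = Matrix.diagonal d := by
  have hR : (B.map Complex.re).PosDef := by
    refine Matrix.PosDef.of_dotProduct_mulVec_pos ?_ fun {x} hx => ?_
    · rw [Matrix.IsHermitian, Matrix.conjTranspose_eq_transpose_of_trivial, ← Matrix.transpose_map,
        hs.eq]
    · have hq : dotProduct (star x) ((B.map Complex.re).mulVec x) = (quadForm B x).re := by
        simp only [quadForm, Complex.re_sum, dotProduct, Matrix.mulVec, mul_sum, star_trivial,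
          Matrix.map_apply]
        refine sum_congr rfl fun i _ => sum_congr rfl fun j _ => ?_
        rw [← Complex.ofReal_mul, Complex.re_mul_ofReal]
        ring
      rw [hq]
      exact hB x hx
  have hS : (B.map Complex.im).IsSymm := by
    rw [Matrix.IsSymm, ← Matrix.transpose_map, hs.eq]
  obtain ⟨G, d, hG, h1, h2⟩ := exists_real_diagonalization hR hS
  refine ⟨G, fun i => 1 + d i * Complex.I, hG, fun i => by simp, ?_⟩
  have hBeq : B = (B.map Complex.re).map Complex.ofRealHom +
      Complex.I • (B.map Complex.im).map Complex.ofRealHom := by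
    ext i j
    simp [mul_comm Complex.I, Complex.re_add_im]
  have h1' := congrArg (fun M => M.map Complex.ofRealHom) h1
  have h2' := congrArg (fun M => M.map Complex.ofRealHom) h2
  simp only [Matrix.map_mul, Matrix.transpose_map] at h1' h2'
  rw [hBeq, Matrix.mul_add, Matrix.add_mul, Matrix.mul_smul, Matrix.smul_mul, h1', h2']
  ext i j
  rcases eq_or_ne i j with rfl | hij
  · simp [mul_comm]
  · simp [hij]

omit [DecidableEq ι] in
lemma map_mulVec_ofReal (G : Matrix ι ι ℝ) (y : ι → ℝ) :
    (fun i => ((G.mulVec y i : ℝ) : ℂ)) = (G.map Complex.ofRealHom).mulVec fun i => (y i : ℂ) := by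
  funext i
  simp [Matrix.mulVec, dotProduct]

lemma integral_comp_mulVec {G : Matrix ι ι ℝ} (hG : G.det ≠ 0) {f : (ι → ℝ) → ℂ}
    (hf : Continuous f) : ∫ x, f x = |G.det| * ∫ y, f (G.mulVec y) := by
  have h := Real.map_matrix_volume_pi_eq_smul_volume_pi hG
  have hc : Continuous (Matrix.toLin' G) := LinearMap.continuous_of_finiteDimensional _
  have h2 : ∫ y, f (G.mulVec y) = ∫ x, f x ∂(Measure.map (Matrix.toLin' G) volume) := by
    rw [integral_map hc.aemeasurable hf.aestronglyMeasurable]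
    simp [Matrix.toLin'_apply]
  rw [h2, h, integral_smul_measure, ENNReal.toReal_ofReal (abs_nonneg _), abs_inv,
    Complex.real_smul, ← mul_assoc, ← Complex.ofReal_mul, mul_inv_cancel₀ (abs_ne_zero.2 hG)]
  simp

/-- The substitution `x = G y` splits the integral into one-dimensional Gaussians. With `w = Gᵀ v`
the exponents add up to the form of `B⁻¹ = G diag(1/d) Gᵀ` at `v`. -/
lemma integral_gaussian_of_diagonal {B : Matrix ι ι ℂ} {G : Matrix ι ι ℝ} {d : ι → ℂ}
    (hG : G.det ≠ 0) (hd : ∀ i, 0 < (d i).re)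
    (h : (G.map Complex.ofRealHom).transpose * B * G.map Complex.ofRealHom = Matrix.diagonal d)
    (v : ι → ℝ) : IsUnit B.det ∧
      ∫ x, gaussian B v x = |G.det| * (∏ i, (1 / d i) ^ (1 / 2 : ℂ)) *
        Complex.exp (-Real.pi * quadForm B⁻¹ v) := by
  set Gc := G.map Complex.ofRealHom with hGc
  have hpi : (Real.pi : ℂ) ≠ 0 := by exact_mod_cast Real.pi_ne_zero
  have hd0 : ∀ i, d i ≠ 0 := fun i h0 => by simpa [h0] using hd i
  have hdet := congrArg Matrix.det h
  rw [Matrix.det_mul, Matrix.det_mul, Matrix.det_diagonal] at hdet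
  have hprod : ∏ i, d i ≠ 0 := prod_ne_zero_iff.2 fun i _ => hd0 i
  have hBdet : IsUnit B.det := isUnit_iff_ne_zero.2 fun h0 => by
    rw [h0] at hdet; simp at hdet; exact hprod hdet.symm
  have hGdet : IsUnit Gc.det := isUnit_iff_ne_zero.2 fun h0 => by
    rw [h0] at hdet; simp at hdet; exact hprod hdet.symm
  refine ⟨hBdet, ?_⟩
  have hGt : IsUnit Gc.transpose.det := by rwa [Matrix.det_transpose]
  have hinv : B⁻¹ = Gc * Matrix.diagonal (fun i => (d i)⁻¹) * Gc.transpose := by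
    apply Matrix.inv_eq_left_inv
    have h1 : Gc.transpose * B = Matrix.diagonal d * Gc⁻¹ := by
      rw [← h, Matrix.mul_assoc _ Gc, Matrix.mul_nonsing_inv _ hGdet, Matrix.mul_one]
    rw [Matrix.mul_assoc, h1, Matrix.mul_assoc, ← Matrix.mul_assoc (Matrix.diagonal _),
      Matrix.diagonal_mul_diagonal]
    simp only [inv_mul_cancel₀ (hd0 _), Matrix.diagonal_one, Matrix.one_mul]
    exact Matrix.mul_nonsing_inv _ hGdet
  set w : ι → ℂ := Gc.transpose.mulVec fun i => (v i : ℂ) with hw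
  have hquad : ∀ y, quadForm B (G.mulVec y) = ∑ i, d i * (y i : ℂ) ^ 2 := by
    intro y
    rw [quadForm_eq_dotProduct, map_mulVec_ofReal, ← hGc, Matrix.mulVec_mulVec,
      Matrix.dotProduct_mulVec, Matrix.vecMul_mulVec, ← Matrix.dotProduct_mulVec,
      ← Matrix.mul_assoc, h]
    simp only [dotProduct, Matrix.mulVec_diagonal]
    exact sum_congr rfl fun i _ => by ring
  have hlin : ∀ y : ι → ℝ, ∑ i, (v i : ℂ) * (G.mulVec y i : ℝ) = ∑ i, w i * y i := by
    intro y
    have := congrFun (map_mulVec_ofReal G y)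
    simp only [this, hw]
    change dotProduct (fun i => (v i : ℂ)) (Gc.mulVec fun i => (y i : ℂ)) =
      dotProduct (Gc.transpose.mulVec fun i => (v i : ℂ)) fun i => (y i : ℂ)
    rw [Matrix.dotProduct_mulVec, Matrix.mulVec_transpose]
  have hqinv : quadForm B⁻¹ v = ∑ i, w i ^ 2 / d i := by
    rw [quadForm_eq_dotProduct, hinv, ← Matrix.mulVec_mulVec, ← Matrix.mulVec_mulVec,
      Matrix.dotProduct_mulVec, ← Matrix.mulVec_transpose, ← hw]
    simp only [dotProduct, Matrix.mulVec_diagonal]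
    exact sum_congr rfl fun i _ => by rw [div_eq_mul_inv]; ring
  rw [integral_comp_mulVec hG (continuous_gaussian B v), mul_assoc]
  congr 1
  have hint := GaussianFourier.integral_cexp_neg_sum_mul_add (b := fun i => Real.pi * d i)
    (fun i => by rw [Complex.re_ofReal_mul]; exact mul_pos Real.pi_pos (hd i))
    (fun i => 2 * Real.pi * Complex.I * w i)
  calc ∫ y, gaussian B v (G.mulVec y)
      = ∫ y : ι → ℝ, Complex.exp (-∑ i, Real.pi * d i * (y i : ℂ) ^ 2 +
          ∑ i, 2 * Real.pi * Complex.I * w i * y i) := by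
        congr 1
        funext y
        rw [gaussian, hquad, hlin, mul_sum, mul_sum, ← sum_neg_distrib]
        congr 2
        · exact sum_congr rfl fun i _ => by ring
        · exact sum_congr rfl fun i _ => by ring
    _ = _ := by
        rw [hint, prod_mul_distrib, ← Complex.exp_sum, hqinv, mul_sum]
        congr 1
        · refine prod_congr rfl fun i _ => ?_
          congr 1
          have := hd0 i
          field_simp
        · congr 1
          refine sum_congr rfl fun i _ => ?_
          have := hd0 i
          field_simp
          rw [Complex.I_sq]
          ring

/-- The total integral of the Gaussian `exp(-π xᵀ B x)`. -/
def gaussInt (B : Matrix ι ι ℂ) : ℂ := ∫ x, gaussian B 0 x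

lemma IsCoercive.isUnit_det {B : Matrix ι ι ℂ} (hB : IsCoercive B) (hs : B.IsSymm) :
    IsUnit B.det := by
  obtain ⟨G, d, hG, hd, h⟩ := hB.exists_diagonalization hs
  exact (integral_gaussian_of_diagonal hG hd h 0).1

theorem IsCoercive.integral_gaussian {B : Matrix ι ι ℂ} (hB : IsCoercive B) (hs : B.IsSymm)
    (v : ι → ℝ) : ∫ x, gaussian B v x =
      gaussInt B * Complex.exp (-Real.pi * quadForm B⁻¹ v) := by
  obtain ⟨G, d, hG, hd, h⟩ := hB.exists_diagonalization hs
  rw [gaussInt, (integral_gaussian_of_diagonal hG hd h v).2,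
    (integral_gaussian_of_diagonal hG hd h 0).2]
  simp [quadForm]

/-- Squaring removes the choice of the roots `(1/d_i)^(1/2)`, which depend on the diagonalization;
the sign is recovered later by continuity. -/
theorem IsCoercive.gaussInt_sq_mul_det {B : Matrix ι ι ℂ} (hB : IsCoercive B) (hs : B.IsSymm) :
    gaussInt B ^ 2 * B.det = 1 := by
  obtain ⟨G, d, hG, hd, h⟩ := hB.exists_diagonalization hs
  have hd0 : ∀ i, d i ≠ 0 := fun i h0 => by simpa [h0] using hd i
  have hprod : ∏ i, d i ≠ 0 := prod_ne_zero_iff.2 fun i _ => hd0 i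
  have hdet := congrArg Matrix.det h
  rw [Matrix.det_mul, Matrix.det_mul, Matrix.det_diagonal, Matrix.det_transpose] at hdet
  have hGd : (G.map Complex.ofRealHom).det = (G.det : ℂ) := by
    have := (Complex.ofRealHom.map_det G).symm
    simpa using this
  have hsq : ((|G.det| : ℝ) : ℂ) ^ 2 = (G.det : ℂ) ^ 2 := by
    rw [← Complex.ofReal_pow, sq_abs, Complex.ofReal_pow]
  have hroot : ∏ i, ((1 / d i) ^ (1 / 2 : ℂ)) ^ 2 = (∏ i, d i)⁻¹ := by
    rw [← prod_inv_distrib]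
    refine prod_congr rfl fun i _ => ?_
    rw [← Complex.cpow_nat_mul]
    simp
  rw [gaussInt, (integral_gaussian_of_diagonal hG hd h 0).2]
  simp only [quadForm, Pi.zero_apply, Complex.ofReal_zero, mul_zero, sum_const_zero,
    Complex.exp_zero, mul_one]
  rw [mul_pow, hsq, ← prod_pow, hroot]
  rw [hGd] at hdet
  field_simp
  linear_combination hdet

-- Dominated convergence, with the bound that is uniform near `B`.
omit [DecidableEq ι] in
lemma IsCoercive.continuousAt_gaussInt {B : Matrix ι ι ℂ} (hB : IsCoercive B) :
    ContinuousAt gaussInt B := by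
  obtain ⟨C, hC0, hC⟩ := hB.exists_eventually_norm_le 1
  have : FirstCountableTopology (Matrix ι ι ℂ) :=
    inferInstanceAs (FirstCountableTopology (ι → ι → ℂ))
  refine continuousAt_of_dominated (bound := fun x => C * decay x) ?_ ?_
    (integrable_decay.const_mul C) ?_
  · exact Eventually.of_forall fun B' => (continuous_gaussian B' 0).aestronglyMeasurable
  · filter_upwards [hC] with B' hB'
    refine Eventually.of_forall fun x => ?_
    simpa [evalR] using hB' 0 x
  · refine Eventually.of_forall fun x => ?_
    have h : Continuous fun B' : Matrix ι ι ℂ => quadForm B' x :=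
      continuous_quadForm_uncurry.comp (Continuous.prodMk_left x)
    unfold gaussian
    fun_prop

-- Positivity for real forms fixes the sign of the square root at the base point `iI`.
omit [DecidableEq ι] in
lemma IsCoercive.gaussInt_ofReal {R : Matrix ι ι ℝ} (hB : IsCoercive (R.map Complex.ofReal)) :
    ∃ t : ℝ, 0 < t ∧ gaussInt (R.map Complex.ofReal) = t := by
  have h1 : ∀ x : ι → ℝ, gaussian (R.map Complex.ofReal) 0 x =
      ((Real.exp (-Real.pi * (quadForm (R.map Complex.ofReal) x).re) : ℝ) : ℂ) := by
    intro x
    have h2 : quadForm (R.map Complex.ofReal) x =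
        ((quadForm (R.map Complex.ofReal) x).re : ℂ) := by
      have h3 : quadForm (R.map Complex.ofReal) x = ((∑ i, ∑ j, R i j * (x i * x j) : ℝ) : ℂ) := by
        simp [quadForm]
      rw [h3, Complex.ofReal_re]
    rw [gaussian, h2]
    simp
  have hint := (hB.integrable 1 0).norm
  refine ⟨∫ x, Real.exp (-Real.pi * (quadForm (R.map Complex.ofReal) x).re), ?_, ?_⟩
  · refine integral_exp_pos ?_
    simpa [evalR, norm_gaussian] using hint
  · rw [gaussInt, ← integral_complex_ofReal]
    exact integral_congr_ae (Eventually.of_forall h1)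

end GaussianIntegral

open MvPolynomial Finset MeasureTheory Filter Topology

/-! ### Poisson summation in several variables -/

section Poisson

variable {ι : Type*} [Fintype ι]

/-- An integer vector, viewed over the reals. -/
def intVec (R : ι → ℤ) : ι → ℝ := fun i => R i

/-- The character `x ↦ exp(2πi v·x)`. -/
def character (v x : ι → ℝ) : ℂ := Complex.exp (2 * Real.pi * Complex.I * ∑ i, (v i : ℂ) * x i)

lemma norm_character (v x : ι → ℝ) : ‖character v x‖ = 1 := by
  have h : 2 * (Real.pi : ℂ) * Complex.I * ∑ i, (v i : ℂ) * x i =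
      ((2 * Real.pi * ∑ i, v i * x i : ℝ) : ℂ) * Complex.I := by
    push_cast; ring
  rw [character, h, Complex.norm_exp_ofReal_mul_I]

lemma character_add (v x y : ι → ℝ) : character v (x + y) = character v x * character v y := by
  rw [character, character, character, ← Complex.exp_add, ← mul_add, ← sum_add_distrib]
  congr 2
  refine sum_congr rfl fun i _ => ?_
  rw [Pi.add_apply, Complex.ofReal_add, mul_add]

lemma character_int_int (S R : ι → ℤ) : character (intVec S) (intVec R) = 1 := by
  rw [character, Complex.exp_eq_one_iff]
  refine ⟨∑ i, S i * R i, ?_⟩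
  simp [intVec]
  ring

lemma continuous_character (v : ι → ℝ) : Continuous (character v) := by
  unfold character; fun_prop

lemma mFourier_coe (S : ι → ℤ) (x : ι → ℝ) :
    UnitAddTorus.mFourier S (fun i => (x i : UnitAddCircle)) = character (intVec S) x := by
  rw [UnitAddTorus.mFourier, ContinuousMap.coe_mk, character, mul_sum, Complex.exp_sum]
  refine prod_congr rfl fun i _ => ?_
  rw [fourier_coe_apply]
  congr 1
  simp [intVec]
  ring

omit [Fintype ι] in
lemma isOpenQuotientMap_torus :
    IsOpenQuotientMap (Pi.map fun _ : ι => ((↑) : ℝ → UnitAddCircle)) :=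
  IsOpenQuotientMap.piMap fun _ => QuotientAddGroup.isOpenQuotientMap_mk

/-- The unit cube. -/
def unitCube : Set (ι → ℝ) := {x | ∀ i, x i ∈ Set.Ioc ((0 : ι → ℝ) i) ((0 : ι → ℝ) i + 1)}

omit [Fintype ι] in
lemma measurableSet_unitCube [Countable ι] : MeasurableSet (unitCube : Set (ι → ℝ)) := by
  have : (unitCube : Set (ι → ℝ)) = Set.pi Set.univ fun _ => Set.Ioc 0 1 := by
    ext x; simp [unitCube]
  rw [this]
  exact MeasurableSet.univ_pi fun _ => measurableSet_Ioc

/-- The integer translates of the cube tile the space, so unfolding is countable additivity of the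
integral. -/
lemma hasSum_integral_unitCube {g : (ι → ℝ) → ℂ} (hg : Integrable g) :
    HasSum (fun R : ι → ℤ => ∫ x in unitCube, g (x + intVec R)) (∫ x, g x) := by
  have hU : (⋃ R : ι → ℤ, (fun x => x + intVec R) '' unitCube) = Set.univ := by
    -- The cube is open on the left and closed on the right, hence `⌈x⌉ - 1` and not the floor.
    refine Set.eq_univ_of_forall fun x => Set.mem_iUnion.2 ⟨fun i => ⌈x i⌉ - 1, ?_⟩
    refine ⟨x - intVec fun i => ⌈x i⌉ - 1, fun i => ?_, by simp⟩
    simp only [Pi.zero_apply, zero_add, Pi.sub_apply, intVec, Int.cast_sub, Int.cast_one,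
      Set.mem_Ioc]
    constructor
    · linarith [Int.ceil_lt_add_one (x i)]
    · linarith [Int.le_ceil (x i)]
  have hd : Pairwise (Function.onFun Disjoint
      fun R : ι → ℤ => (fun x => x + intVec R) '' (unitCube : Set (ι → ℝ))) := by
    intro R S hRS
    rw [Function.onFun, Set.disjoint_left]
    rintro _ ⟨x, hx, rfl⟩ ⟨y, hy, hxy⟩
    refine hRS (funext fun i => ?_)
    have h1 := congrFun hxy i
    simp only [Pi.add_apply, intVec] at h1
    have hxi := hx i
    have hyi := hy i
    simp only [Pi.zero_apply, zero_add, Set.mem_Ioc] at hxi hyi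
    have h2 : ((R i - S i : ℤ) : ℝ) < 1 := by push_cast; linarith
    have h3 : ((S i - R i : ℤ) : ℝ) < 1 := by push_cast; linarith
    have h2' : R i - S i < 1 := by exact_mod_cast h2
    have h3' : S i - R i < 1 := by exact_mod_cast h3
    omega
  have hm : ∀ R : ι → ℤ, MeasurableSet ((fun x => x + intVec R) '' (unitCube : Set (ι → ℝ))) :=
    fun R => (MeasurableEquiv.addRight (intVec R)).measurableEmbedding.measurableSet_image.2
      measurableSet_unitCube
  have h := hasSum_integral_iUnion hm hd (f := g) (μ := volume) (by rw [hU]; exact hg.integrableOn)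
  rw [hU, Measure.restrict_univ] at h
  convert! h using 2 with R
  exact ((measurePreserving_add_right volume (intVec R)).setIntegral_image_emb
    (MeasurableEquiv.addRight (intVec R)).measurableEmbedding g unitCube).symm

/-- **Poisson summation** in several variables, for rapidly decaying functions. -/
theorem hasSum_poisson {f : (ι → ℝ) → ℂ} (hf : Continuous f) {C : ℝ}
    (hC : ∀ x, ‖f x‖ ≤ C * decay x)
    (hs : Summable fun S : ι → ℤ => ∫ x, character (intVec (-S)) x * f x) (h : ι → ℝ) :
    HasSum (fun S : ι → ℤ => (∫ x, character (intVec (-S)) x * f x) * character (intVec S) h)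
      (∑' R : ι → ℤ, f (h + intVec R)) := by
  have hC0 : 0 ≤ C := by
    have h0 : decay (0 : ι → ℝ) = 1 := by simp [decay]
    have := (norm_nonneg _).trans (hC 0)
    rwa [h0, mul_one] at this
  -- The periodization of `f`; it descends to a continuous function `G` on the torus, whose Fourier
  -- series is then evaluated at `h`.
  set F : (ι → ℝ) → ℂ := fun x => ∑' R : ι → ℤ, f (x + intVec R) with hF
  have hbound : ∀ (x : ι → ℝ) (R : ι → ℤ),
      ‖f (x + intVec R)‖ ≤ C * ((∏ i, (2 * (1 + x i ^ 2))) * decay (intVec R)) :=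
    fun x R => (hC _).trans (mul_le_mul_of_nonneg_left (decay_add_le _ _) hC0)
  have hFc : Continuous F := by
    -- The dominating factor grows with `x`, so uniform convergence holds only locally, where that
    -- factor stays below `K`.
    refine continuous_iff_continuousAt.2 fun x₀ => ?_
    have hcont : Continuous fun x : ι → ℝ => ∏ i, (2 * (1 + x i ^ 2)) := by fun_prop
    set K := (∏ i, (2 * (1 + x₀ i ^ 2))) + 1 with hK
    have hopen : IsOpen {x : ι → ℝ | ∏ i, (2 * (1 + x i ^ 2)) < K} :=
      isOpen_lt hcont continuous_const
    refine ContinuousOn.continuousAt (s := {x : ι → ℝ | ∏ i, (2 * (1 + x i ^ 2)) < K}) ?_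
      (hopen.mem_nhds (by simp [hK]))
    refine continuousOn_tsum (u := fun R : ι → ℤ => C * (K * decay (intVec R))) (fun R => ?_)
      ((summable_decay_int.mul_left K).mul_left C) fun R x hx => ?_
    · exact (hf.comp (by fun_prop)).continuousOn
    · refine (hbound x R).trans (mul_le_mul_of_nonneg_left ?_ hC0)
      exact mul_le_mul_of_nonneg_right (le_of_lt hx) (decay_nonneg _)
  have hFper : ∀ x (T : ι → ℤ), F (x + intVec T) = F x := by
    intro x T
    rw [hF]
    simp only
    rw [← (Equiv.addLeft T).tsum_eq fun R : ι → ℤ => f (x + intVec R)]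
    refine tsum_congr fun R => ?_
    congr 1
    funext i
    simp [intVec]
    ring
  have hfac : Function.FactorsThrough F (Pi.map fun _ : ι => ((↑) : ℝ → UnitAddCircle)) := by
    intro x y hxy
    have : ∀ i, ∃ n : ℤ, y i = x i + n := by
      intro i
      have h1 : ((x i : ℝ) : UnitAddCircle) = (y i : ℝ) := congrFun hxy i
      rw [QuotientAddGroup.eq] at h1
      obtain ⟨n, hn⟩ := AddSubgroup.mem_zmultiples_iff.1 h1
      refine ⟨n, ?_⟩
      simp only [zsmul_eq_mul, mul_one] at hn
      linarith
    choose T hT using this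
    have hy : y = x + intVec T := funext hT
    rw [hy, hFper]
  let q : C(ι → ℝ, UnitAddTorus ι) := ⟨_, (isOpenQuotientMap_torus (ι := ι)).continuous⟩
  have hq : Topology.IsQuotientMap q := (isOpenQuotientMap_torus (ι := ι)).isQuotientMap
  let G : C(UnitAddTorus ι, ℂ) := hq.lift ⟨F, hFc⟩ hfac
  have hG : ∀ x : ι → ℝ, G (fun i => (x i : UnitAddCircle)) = F x := by
    intro x
    exact congrArg (fun g : C(ι → ℝ, ℂ) => g x)
      (hq.lift_comp ⟨F, hFc⟩ hfac)
  have hcoef : ∀ S : ι → ℤ, UnitAddTorus.mFourierCoeff G S =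
      ∫ x, character (intVec (-S)) x * f x := by
    intro S
    have hg : Integrable fun x => character (intVec (-S)) x * f x := by
      refine (integrable_decay.const_mul C).mono'
        ((continuous_character _).mul hf).aestronglyMeasurable (Eventually.of_forall fun x => ?_)
      rw [norm_mul, norm_character, one_mul]
      exact hC x
    rw [UnitAddTorus.mFourierCoeff_eq_integral _ _ 0]
    simp only [hG, mFourier_coe, smul_eq_mul]
    -- The shape `Ioc (0 i) (0 i + 1)` in `unitCube` makes it definitionally the domain of the torus
    -- integral based at `0`.
    change ∫ x in unitCube, _ = _
    have hK : ∀ x ∈ (unitCube : Set (ι → ℝ)),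
        ∏ i, (2 * (1 + x i ^ 2)) ≤ ∏ _i : ι, (4 : ℝ) := by
      intro x hx
      refine prod_le_prod (fun i _ => by positivity) fun i _ => ?_
      have := hx i
      simp only [Pi.zero_apply, zero_add, Set.mem_Ioc] at this
      nlinarith
    have hvol : volume (unitCube : Set (ι → ℝ)) < ⊤ := by
      have : (unitCube : Set (ι → ℝ)) = Set.pi Set.univ fun _ => Set.Ioc 0 1 := by
        ext x; simp [unitCube]
      rw [this, Real.volume_pi_Ioc]
      simp
    have : IsFiniteMeasure ((volume : Measure (ι → ℝ)).restrict unitCube) :=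
      ⟨by simpa using hvol⟩
    refine ((hasSum_integral_unitCube hg).unique ?_).symm
    have h1 := hasSum_integral_of_summable_integral_norm
      (μ := (volume : Measure (ι → ℝ)).restrict unitCube)
      (F := fun (R : ι → ℤ) x => character (intVec (-S)) (x + intVec R) * f (x + intVec R))
      (fun R => (hg.comp_add_right (intVec R)).integrableOn) ?_
    · convert! h1 using 1
      refine setIntegral_congr_fun measurableSet_unitCube fun x _ => ?_
      simp only [hF, ← tsum_mul_left]
      refine tsum_congr fun R => ?_
      rw [character_add, character_int_int, mul_one]
    -- Sum and integral may be exchanged: on the cube each factor `2(1 + x_i²)` is at most `4`, so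
    -- `decay` at the lattice point dominates.
    · refine Summable.of_nonneg_of_le (fun R => integral_nonneg fun x => norm_nonneg _)
        (fun R => ?_) ((summable_decay_int (ι := ι)).mul_left
          (C * (∏ _i : ι, (4 : ℝ)) * (volume : Measure (ι → ℝ)).real unitCube))
      calc ∫ x in unitCube, ‖character (intVec (-S)) (x + intVec R) * f (x + intVec R)‖
          ≤ ∫ _x in (unitCube : Set (ι → ℝ)), C * ((∏ _i : ι, (4 : ℝ)) * decay (intVec R)) := by
            refine setIntegral_mono_on ?_ ?_ measurableSet_unitCube fun x hx => ?_
            · exact (hg.comp_add_right (intVec R)).norm.integrableOn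
            · exact integrable_const _
            · rw [norm_mul, norm_character, one_mul]
              refine (hbound x R).trans (mul_le_mul_of_nonneg_left ?_ hC0)
              exact mul_le_mul_of_nonneg_right (hK x hx) (decay_nonneg _)
        _ = _ := by
            rw [setIntegral_const, smul_eq_mul]
            change _ = _ * decay (intVec R)
            ring
  have hsum : Summable (UnitAddTorus.mFourierCoeff G) := by
    have : UnitAddTorus.mFourierCoeff G =
        fun S : ι → ℤ => ∫ x, character (intVec (-S)) x * f x := funext hcoef
    rw [this]; exact hs
  have := UnitAddTorus.hasSum_mFourier_series_apply_of_summable hsum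
    (fun i => (h i : UnitAddCircle))
  simpa only [hG, hcoef, mFourier_coe, smul_eq_mul] using this

lemma character_mul_gaussian (B : Matrix ι ι ℂ) (w v x : ι → ℝ) :
    character w x * gaussian B v x = gaussian B (v + w) x := by
  rw [character, gaussian, gaussian, ← Complex.exp_add]
  congr 1
  simp only [Pi.add_apply, Complex.ofReal_add, add_mul, sum_add_distrib]
  ring

lemma evalR_linComp [DecidableEq ι] (L : Matrix ι ι ℂ) (p : MvPolynomial ι ℂ) (x : ι → ℝ) :
    evalR (linComp L p) x = eval (L.mulVec fun i => (x i : ℂ)) p := eval_linComp L _ p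

/-- Poisson summation for a polynomial times a Gaussian. -/
theorem tsum_evalR_mul_gaussian [DecidableEq ι] {B : Matrix ι ι ℂ} (hB : IsCoercive B)
    (hs : B.IsSymm) (hB' : IsCoercive B⁻¹) (p : MvPolynomial ι ℂ) (k h : ι → ℝ) :
    ∑' R : ι → ℤ, evalR p (h + intVec R) * gaussian B k (h + intVec R) =
      gaussInt B * character k h * ∑' S : ι → ℤ,
        evalR (linComp (Complex.I • B⁻¹) (heat ((4 * Real.pi : ℂ)⁻¹ • B⁻¹) p)) (k + intVec S) *
          gaussian B⁻¹ (-h) (k + intVec S) := by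
  set q := linComp (Complex.I • B⁻¹) (heat ((4 * Real.pi : ℂ)⁻¹ • B⁻¹) p) with hq
  have hint : ∀ S : ι → ℤ, ∫ x, character (intVec (-S)) x * (evalR p x * gaussian B k x) =
      gaussInt B * (evalR q (k + intVec (-S)) * gaussian B⁻¹ 0 (k + intVec (-S))) := by
    intro S
    have h1 : ∀ x, character (intVec (-S)) x * (evalR p x * gaussian B k x) =
        evalR p x * gaussian B (k + intVec (-S)) x := by
      intro x
      rw [mul_left_comm, character_mul_gaussian]
    simp only [h1]
    rw [← gaussianFunctional_apply hB, gaussianFunctional_eq hB hs (hB.isUnit_det hs),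
      hB.integral_gaussian hs, hq, evalR_linComp, Matrix.smul_mulVec]
    have h2 : gaussian B⁻¹ 0 (k + intVec (-S)) =
        Complex.exp (-Real.pi * quadForm B⁻¹ (k + intVec (-S))) := by
      simp [gaussian]
    rw [h2, mul_assoc, mul_comm (Complex.exp _)]
    rfl
  obtain ⟨C, hC0, hC⟩ := hB.exists_norm_le p
  have hsum : Summable fun S : ι → ℤ =>
      ∫ x, character (intVec (-S)) x * (evalR p x * gaussian B k x) := by
    simp only [hint]
    -- The Fourier coefficient at `S` has frequency `k - S`; the reflection `S ↦ -S` brings it to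
    -- the form `k + S` of the statement.
    exact ((Equiv.neg (ι → ℤ)).summable_iff.2 (hB'.summable q 0 k)).mul_left _
  have hp := (hasSum_poisson ((continuous_evalR p).mul (continuous_gaussian B k)) (hC k) hsum
    h).tsum_eq
  simp only [Pi.mul_apply] at hp
  rw [← hp, ← (Equiv.neg (ι → ℤ)).tsum_eq, ← tsum_mul_left]
  refine tsum_congr fun S => ?_
  rw [hint, Equiv.neg_apply, neg_neg]
  -- Phases: `-S·h = k·h - (k + S)·h`. The first term leaves the sum and the second becomes the
  -- frequency `-h`.
  have h3 : gaussian B⁻¹ 0 (k + intVec S) * character (intVec (-S)) h =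
      character k h * gaussian B⁻¹ (-h) (k + intVec S) := by
    rw [character, gaussian, gaussian, character, ← Complex.exp_add, ← Complex.exp_add]
    congr 1
    have h4 : ∑ i, ((intVec (-S) i : ℝ) : ℂ) * h i = ∑ i, (k i : ℂ) * h i +
        ∑ i, (((-h) i : ℝ) : ℂ) * ((k + intVec S) i : ℝ) := by
      rw [← sum_add_distrib]
      refine sum_congr rfl fun i _ => ?_
      simp [intVec]
      ring
    rw [h4]
    simp
    ring
  linear_combination gaussInt B * evalR q (k + intVec S) * h3

end Poisson

open MvPolynomial Finset MeasureTheory Filter Topology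
open scoped Kronecker

/-! ### Theta series as lattice sums of polynomials times Gaussians -/

section Siegel

variable {m n : ℕ}

/-- A matrix, viewed as a vector indexed by pairs. -/
def vec {R : Type*} {k l : ℕ} (U : Matrix (Fin k) (Fin l) R) : Fin k × Fin l → R :=
  fun ij => U ij.1 ij.2

lemma ofReal_vec (U : Matrix (Fin m) (Fin n) ℝ) :
    (fun ij => ((vec U ij : ℝ) : ℂ)) = vec (toC U) := rfl

lemma vec_add {R : Type*} [Add R] (U V : Matrix (Fin m) (Fin n) R) :
    vec (U + V) = vec U + vec V := rfl

lemma vec_toR (R : Matrix (Fin m) (Fin n) ℤ) : vec (toR R) = intVec (vec R) := rfl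

lemma kronecker_mulVec_vec {R : Type*} [CommSemiring R] (A : Matrix (Fin m) (Fin m) R)
    (M : Matrix (Fin n) (Fin n) R) (U : Matrix (Fin m) (Fin n) R) :
    (A ⊗ₖ M).mulVec (vec U) = vec (A * U * M.transpose) := by
  funext ⟨i, j⟩
  simp only [Matrix.mulVec, dotProduct, vec, Fintype.sum_prod_type, Matrix.kronecker_apply,
    Matrix.mul_apply, Matrix.transpose_apply, sum_mul]
  rw [sum_comm]
  exact sum_congr rfl fun a _ => sum_congr rfl fun b _ => by ring

lemma dotProduct_vec {R : Type*} [CommSemiring R] (U V : Matrix (Fin m) (Fin n) R) :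
    dotProduct (vec U) (vec V) = (U.transpose * V).trace := by
  simp only [dotProduct, vec, Fintype.sum_prod_type, Matrix.trace, Matrix.diag, Matrix.mul_apply,
    Matrix.transpose_apply]
  rw [sum_comm]

lemma toC_mul {k l r : ℕ} (B : Matrix (Fin k) (Fin l) ℝ) (C : Matrix (Fin l) (Fin r) ℝ) :
    toC (B * C) = toC B * toC C := Matrix.map_mul (f := Complex.ofRealHom)

lemma toC_one {k : ℕ} : toC (1 : Matrix (Fin k) (Fin k) ℝ) = 1 :=
  Matrix.map_one _ Complex.ofReal_zero Complex.ofReal_one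

lemma toC_transpose {k l : ℕ} (B : Matrix (Fin k) (Fin l) ℝ) :
    toC B.transpose = (toC B).transpose := rfl

lemma toC_det {k : ℕ} (B : Matrix (Fin k) (Fin k) ℝ) : (toC B).det = (B.det : ℂ) :=
  (Complex.ofRealHom.map_det B).symm

lemma toC_inv {k : ℕ} {B : Matrix (Fin k) (Fin k) ℝ} (hB : IsUnit B.det) :
    toC B⁻¹ = (toC B)⁻¹ := by
  symm
  apply Matrix.inv_eq_left_inv
  rw [← toC_mul, Matrix.nonsing_inv_mul _ hB, toC_one]

lemma toC_isSymm {k : ℕ} {B : Matrix (Fin k) (Fin k) ℝ} (hB : B.IsSymm) : (toC B).IsSymm := by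
  rw [Matrix.IsSymm, ← toC_transpose, hB.eq]

lemma isSymm_of_posDef {k : ℕ} {B : Matrix (Fin k) (Fin k) ℝ} (hB : B.PosDef) : B.IsSymm := by
  have := hB.isHermitian
  rwa [Matrix.IsHermitian, Matrix.conjTranspose_eq_transpose_of_trivial] at this

lemma isUnit_det_of_posDef {k : ℕ} {B : Matrix (Fin k) (Fin k) ℝ} (hB : B.PosDef) :
    IsUnit B.det := isUnit_iff_ne_zero.2 hB.det_pos.ne'

lemma isSymm_kronecker {R : Type*} [CommSemiring R] {A : Matrix (Fin m) (Fin m) R}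
    {M : Matrix (Fin n) (Fin n) R} (hA : A.IsSymm) (hM : M.IsSymm) : (A ⊗ₖ M).IsSymm := by
  rw [Matrix.IsSymm, ← Matrix.kroneckerMap_transpose, hA.eq, hM.eq]

lemma quadForm_kronecker (A : Matrix (Fin m) (Fin m) ℝ) (M : Matrix (Fin n) (Fin n) ℂ)
    (U : Matrix (Fin m) (Fin n) ℝ) :
    quadForm (toC A ⊗ₖ M) (vec U) = (toC (U.transpose * A * U) * M.transpose).trace := by
  rw [quadForm_eq_dotProduct, ofReal_vec, kronecker_mulVec_vec, dotProduct_vec]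
  simp only [toC_mul, toC_transpose, Matrix.mul_assoc]

lemma re_quadForm {ι : Type*} [Fintype ι] (B : Matrix ι ι ℂ) (x : ι → ℝ) :
    (quadForm B x).re = dotProduct x ((B.map Complex.re).mulVec x) := by
  simp only [quadForm, Complex.re_sum, dotProduct, Matrix.mulVec, mul_sum, Matrix.map_apply]
  refine sum_congr rfl fun i _ => sum_congr rfl fun j _ => ?_
  rw [← Complex.ofReal_mul, Complex.re_mul_ofReal]
  ring

lemma isCoercive_of_posDef {ι : Type*} [Fintype ι] {B : Matrix ι ι ℂ}
    (hB : (B.map Complex.re).PosDef) : IsCoercive B := by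
  intro x hx
  rw [re_quadForm]
  simpa using hB.dotProduct_mulVec_pos hx

lemma isCoercive_kronecker {A : Matrix (Fin m) (Fin m) ℝ} {M : Matrix (Fin n) (Fin n) ℂ}
    (hA : A.PosDef) (hM : (M.map Complex.re).PosDef) : IsCoercive (toC A ⊗ₖ M) := by
  refine isCoercive_of_posDef ?_
  have h : (toC A ⊗ₖ M).map Complex.re = A ⊗ₖ M.map Complex.re := by
    ext i j
    simp [toC]
  rw [h]
  exact hA.kronecker hM

lemma map_re_neg_I_smul (Z : Matrix (Fin n) (Fin n) ℂ) :
    ((-Complex.I) • Z).map Complex.re = Z.map Complex.im := by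
  ext i j; simp

/-- Since `πi = -π · (-i)`, the factor `-i` carries the half-space to matrices with positive
definite real part. -/
lemma expFactor_eq_gaussian {A : Matrix (Fin m) (Fin m) ℤ} (hA : (toR A).PosDef)
    {Z : Matrix (Fin n) (Fin n) ℂ} (hZ : Z.IsSymm) (K U : Matrix (Fin m) (Fin n) ℝ) :
    expFactor A K Z U =
      gaussian (toC (toR A) ⊗ₖ ((-Complex.I) • Z)) (vec (toR A * K)) (vec U) := by
  have h : ∑ ij, ((vec (toR A * K) ij : ℝ) : ℂ) * (vec U ij : ℝ) =
      (((K.transpose * toR A * U).trace : ℝ) : ℂ) := by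
    have := dotProduct_vec (toR A * K) U
    rw [Matrix.transpose_mul, (isSymm_of_posDef hA).eq] at this
    rw [← this]
    simp [dotProduct]
  rw [expFactor, e, gaussian, h, quadForm_kronecker, Matrix.transpose_smul, hZ.eq,
    Matrix.mul_smul, Matrix.trace_smul, smul_eq_mul]
  congr 1
  ring

lemma trLaplace_eq_quadDiff (A : Matrix (Fin m) (Fin m) ℤ)
    (P : MvPolynomial (Fin m × Fin n) ℂ) :
    trLaplace A P = quadDiff ((toC (toR A))⁻¹ ⊗ₖ (1 : Matrix (Fin n) (Fin n) ℂ)) P := by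
  simp only [trLaplace, quadDiff_apply, Fintype.sum_prod_type, Matrix.kronecker_apply,
    Matrix.one_apply, mul_ite, mul_one, mul_zero, ite_smul, zero_smul, sum_ite_eq, mem_univ,
    if_true, C_mul', Derivation.map_smul]
  rw [sum_comm]

lemma expTrLaplace_eq_heat (A : Matrix (Fin m) (Fin m) ℤ) (c : ℂ)
    (P : MvPolynomial (Fin m × Fin n) ℂ) :
    expTrLaplace A c P = heat (c • ((toC (toR A))⁻¹ ⊗ₖ (1 : Matrix (Fin n) (Fin n) ℂ))) P := by
  have h : (trLaplace A : MvPolynomial (Fin m × Fin n) ℂ → MvPolynomial (Fin m × Fin n) ℂ) =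
      quadDiff ((toC (toR A))⁻¹ ⊗ₖ (1 : Matrix (Fin n) (Fin n) ℂ)) :=
    funext (trLaplace_eq_quadDiff A)
  rw [expTrLaplace, heat]
  refine finsum_congr fun k => ?_
  rw [quadDiff_smul, smul_pow, LinearMap.smul_apply, smul_smul, h, C_mul', ← Module.End.coe_pow]
  congr 1
  rw [div_eq_mul_inv, mul_comm]

/-- Polynomials over an infinite field that agree at all points are equal, which turns homogeneity
of values into an identity that `heat` can be applied to. -/
lemma linComp_of_isDetHomogeneous {α : ℕ} {P : MvPolynomial (Fin m × Fin n) ℂ}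
    (hP : IsDetHomogeneous α P) (N : Matrix (Fin n) (Fin n) ℂ) :
    linComp ((1 : Matrix (Fin m) (Fin m) ℂ) ⊗ₖ N.transpose) P = N.det ^ α • P := by
  refine MvPolynomial.funext fun x => ?_
  obtain ⟨U, rfl⟩ : ∃ U : Matrix (Fin m) (Fin n) ℂ, x = vec U :=
    ⟨Matrix.of fun i j => x (i, j), rfl⟩
  rw [eval_linComp, smul_eval, kronecker_mulVec_vec, Matrix.one_mul, Matrix.transpose_transpose]
  exact hP U N

lemma inv_toC_toR_isSymm {A : Matrix (Fin m) (Fin m) ℤ} (hA : (toR A).PosDef) :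
    (toC (toR A))⁻¹.IsSymm := by
  rw [← toC_inv (isUnit_det_of_posDef hA)]
  exact toC_isSymm (isSymm_of_posDef hA.inv)

/-- Homogeneity survives the exponential if `S` is changed to `NᵀSN`. It is used for `N = Y^{1/2}`,
to remove the root, and for the complex `N = Z`, to produce `(det Z)^α`. -/
lemma heat_linComp_kronecker {α : ℕ} {A : Matrix (Fin m) (Fin m) ℤ} (hA : (toR A).PosDef)
    {P : MvPolynomial (Fin m × Fin n) ℂ} (hP : IsDetHomogeneous α P)
    {N S : Matrix (Fin n) (Fin n) ℂ} (hS : S.IsSymm) (c : ℂ) (U : Matrix (Fin m) (Fin n) ℂ) :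
    eval (vec (U * N)) (heat (c • ((toC (toR A))⁻¹ ⊗ₖ (N.transpose * S * N))) P) =
      N.det ^ α * eval (vec U) (heat (c • ((toC (toR A))⁻¹ ⊗ₖ S)) P) := by
  have hs : (c • ((toC (toR A))⁻¹ ⊗ₖ S)).IsSymm := by
    rw [Matrix.IsSymm, Matrix.transpose_smul, (isSymm_kronecker (inv_toC_toR_isSymm hA) hS).eq]
  have h := heat_linComp (L := (1 : Matrix (Fin m) (Fin m) ℂ) ⊗ₖ N.transpose) hs (vec U) P
  rw [linComp_of_isDetHomogeneous hP, heat_smul hs, smul_eval, kronecker_mulVec_vec,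
    Matrix.one_mul, Matrix.transpose_transpose] at h
  rw [h]
  congr 2
  rw [← Matrix.kroneckerMap_transpose, Matrix.transpose_one, Matrix.transpose_transpose,
    Matrix.mul_smul, Matrix.smul_mul, ← Matrix.mul_kronecker_mul, ← Matrix.mul_kronecker_mul,
    Matrix.one_mul, Matrix.mul_one]

/-- The polynomial `exp(-(1/8π) ∑ (A⁻¹)_{μρ} (Y⁻¹)_{νσ} ∂_{μν} ∂_{ρσ}) P`. -/
def twistedPoly (A : Matrix (Fin m) (Fin m) ℤ) (P : MvPolynomial (Fin m × Fin n) ℂ)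
    (Y : Matrix (Fin n) (Fin n) ℝ) : MvPolynomial (Fin m × Fin n) ℂ :=
  heat ((-1 / (8 * (Real.pi : ℂ))) • ((toC (toR A))⁻¹ ⊗ₖ toC Y⁻¹)) P

/-- Take `N = Y^{1/2}` and `S = Y⁻¹`, so that `NᵀSN = 1`: the root moves from the argument into the
operator. -/
lemma modifiedPoly_mul_sqrt {α : ℕ} {A : Matrix (Fin m) (Fin m) ℤ} (hA : (toR A).PosDef)
    {P : MvPolynomial (Fin m × Fin n) ℂ} (hP : IsDetHomogeneous α P)
    {Y : Matrix (Fin n) (Fin n) ℝ} (hY : Y.PosDef) (U : Matrix (Fin m) (Fin n) ℝ) :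
    modifiedPoly A P (U * CFC.sqrt Y) =
      (Y.det ^ ((α : ℝ) / 2) : ℝ) * evalR (twistedPoly A P Y) (vec U) := by
  set N := CFC.sqrt Y with hN
  have hNN : N * N = Y := CFC.sqrt_mul_sqrt_self Y hY.posSemidef.nonneg
  have hNs : N.IsSymm := by
    have := (Matrix.nonneg_iff_posSemidef.1 (CFC.sqrt_nonneg Y)).isHermitian
    rwa [Matrix.IsHermitian, Matrix.conjTranspose_eq_transpose_of_trivial] at this
  have hdet : N.det = Real.sqrt Y.det := by
    simpa using hY.posSemidef.det_sqrt
  have hYinv : N * Y⁻¹ * N = 1 := by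
    have hNu : IsUnit N.det := by
      rw [hdet]; exact isUnit_iff_ne_zero.2 (Real.sqrt_pos.2 hY.det_pos).ne'
    rw [← hNN, Matrix.mul_inv_rev, ← Matrix.mul_assoc, Matrix.mul_nonsing_inv _ hNu,
      Matrix.one_mul, Matrix.nonsing_inv_mul _ hNu]
  have h := heat_linComp_kronecker hA hP (N := toC N)
    (toC_isSymm (isSymm_of_posDef hY.inv)) (-1 / (8 * (Real.pi : ℂ))) (toC U)
  rw [← toC_transpose, hNs.eq, ← toC_mul N, ← toC_mul (N * Y⁻¹), hYinv, toC_one, ← toC_mul] at h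
  rw [modifiedPoly, expTrLaplace_eq_heat]
  refine h.trans ?_
  rw [toC_det, hdet]
  congr 1
  rw [← Complex.ofReal_pow, Real.sqrt_eq_rpow, ← Real.rpow_natCast, ← Real.rpow_mul hY.det_pos.le]
  congr 2
  ring

lemma thetaTerm_eq {α : ℕ} {A : Matrix (Fin m) (Fin m) ℤ} (hA : (toR A).PosDef)
    {P : MvPolynomial (Fin m × Fin n) ℂ} (hP : IsDetHomogeneous α P)
    {Z : Matrix (Fin n) (Fin n) ℂ} (hZ : Z ∈ upperHalfSpace n) (K U : Matrix (Fin m) (Fin n) ℝ) :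
    thetaTerm (modifiedPoly A P) A K Z U =
      ((Z.map Complex.im).det ^ ((α : ℝ) / 2) : ℝ) *
        (evalR (twistedPoly A P (Z.map Complex.im)) (vec U) *
          gaussian (toC (toR A) ⊗ₖ ((-Complex.I) • Z)) (vec (toR A * K)) (vec U)) := by
  rw [thetaTerm, modifiedPoly_mul_sqrt hA hP hZ.2, expFactor_eq_gaussian hA hZ.1, mul_assoc]

/-- Integer matrices as integer vectors. -/
def vecEquiv : Matrix (Fin m) (Fin n) ℤ ≃ (Fin m × Fin n → ℤ) where
  toFun := vec
  invFun x := fun i j => x (i, j)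
  left_inv _ := rfl
  right_inv _ := rfl

lemma isCoercive_of_mem {A : Matrix (Fin m) (Fin m) ℤ} (hA : (toR A).PosDef)
    {Z : Matrix (Fin n) (Fin n) ℂ} (hZ : Z ∈ upperHalfSpace n) :
    IsCoercive (toC (toR A) ⊗ₖ ((-Complex.I) • Z)) :=
  isCoercive_kronecker hA (by rw [map_re_neg_I_smul]; exact hZ.2)

lemma summable_poly_gaussian {A : Matrix (Fin m) (Fin m) ℤ} (hA : (toR A).PosDef)
    {Z : Matrix (Fin n) (Fin n) ℂ} (hZ : Z ∈ upperHalfSpace n)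
    (q : MvPolynomial (Fin m × Fin n) ℂ) (v : Fin m × Fin n → ℝ)
    (H : Matrix (Fin m) (Fin n) ℝ) :
    Summable fun R : Matrix (Fin m) (Fin n) ℤ => evalR q (vec (H + toR R)) *
      gaussian (toC (toR A) ⊗ₖ ((-Complex.I) • Z)) v (vec (H + toR R)) :=
  vecEquiv.summable_iff.2 ((isCoercive_of_mem hA hZ).summable q v (vec H))

theorem summable_thetaTerm {α : ℕ} {A : Matrix (Fin m) (Fin m) ℤ} (hA : (toR A).PosDef)
    {P : MvPolynomial (Fin m × Fin n) ℂ} (hP : IsDetHomogeneous α P)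
    {Z : Matrix (Fin n) (Fin n) ℂ} (hZ : Z ∈ upperHalfSpace n) (H K : Matrix (Fin m) (Fin n) ℝ) :
    Summable fun R : Matrix (Fin m) (Fin n) ℤ =>
      thetaTerm (modifiedPoly A P) A K Z (H + toR R) := by
  simp only [thetaTerm_eq hA hP hZ]
  exact (summable_poly_gaussian hA hZ _ _ H).mul_left _

theorem theta_eq_tsum {α : ℕ} {A : Matrix (Fin m) (Fin m) ℤ} (hA : (toR A).PosDef)
    {P : MvPolynomial (Fin m × Fin n) ℂ} (hP : IsDetHomogeneous α P)
    {Z : Matrix (Fin n) (Fin n) ℂ} (hZ : Z ∈ upperHalfSpace n) (H K : Matrix (Fin m) (Fin n) ℝ) :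
    theta (α : ℤ) (modifiedPoly A P) A H K Z =
      ∑' R : Matrix (Fin m) (Fin n) ℤ,
        evalR (twistedPoly A P (Z.map Complex.im)) (vec (H + toR R)) *
          gaussian (toC (toR A) ⊗ₖ ((-Complex.I) • Z)) (vec (toR A * K)) (vec (H + toR R)) := by
  simp only [theta, thetaTerm_eq hA hP hZ]
  rw [tsum_mul_left, ← mul_assoc, ← Complex.ofReal_mul, ← Real.rpow_add hZ.2.det_pos]
  have : -((α : ℤ) : ℝ) / 2 + (α : ℝ) / 2 = 0 := by push_cast; ring
  rw [this, Real.rpow_zero, Complex.ofReal_one, one_mul]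

end Siegel

open MvPolynomial Finset MeasureTheory Filter Topology
open scoped Kronecker

/-! ### The inversion `Z ↦ -Z⁻¹` -/

section Inversion

variable {m n : ℕ}

lemma eq_re_add_im (Z : Matrix (Fin n) (Fin n) ℂ) :
    Z = toC (Z.map Complex.re) + Complex.I • toC (Z.map Complex.im) := by
  ext i j
  simp [toC, mul_comm Complex.I, Complex.re_add_im]

/-- The matrix `X Y⁻¹ X + Y`, the inverse of the imaginary part of `-Z⁻¹`. -/
def imInv (Z : Matrix (Fin n) (Fin n) ℂ) : Matrix (Fin n) (Fin n) ℝ :=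
  Z.map Complex.re * (Z.map Complex.im)⁻¹ * Z.map Complex.re + Z.map Complex.im

lemma map_re_isSymm {Z : Matrix (Fin n) (Fin n) ℂ} (hZ : Z.IsSymm) :
    (Z.map Complex.re).IsSymm := by
  rw [Matrix.IsSymm, ← Matrix.transpose_map, hZ.eq]

lemma imInv_posDef {Z : Matrix (Fin n) (Fin n) ℂ} (hZ : Z ∈ upperHalfSpace n) :
    (imInv Z).PosDef := by
  refine Matrix.PosDef.posSemidef_add ?_ hZ.2
  have := hZ.2.inv.posSemidef.conjTranspose_mul_mul_same (Z.map Complex.re)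
  rwa [Matrix.conjTranspose_eq_transpose_of_trivial, (map_re_isSymm hZ.1).eq] at this

lemma toC_im_inv_mul {Z : Matrix (Fin n) (Fin n) ℂ} (hZ : Z ∈ upperHalfSpace n) :
    toC (Z.map Complex.im)⁻¹ * toC (Z.map Complex.im) = 1 := by
  rw [← toC_mul, Matrix.nonsing_inv_mul _ (isUnit_det_of_posDef hZ.2), toC_one]

lemma toC_im_mul_inv {Z : Matrix (Fin n) (Fin n) ℂ} (hZ : Z ∈ upperHalfSpace n) :
    toC (Z.map Complex.im) * toC (Z.map Complex.im)⁻¹ = 1 := by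
  rw [← toC_mul, Matrix.mul_nonsing_inv _ (isUnit_det_of_posDef hZ.2), toC_one]

lemma toC_imInv (Z : Matrix (Fin n) (Fin n) ℂ) : toC (imInv Z) =
    toC (Z.map Complex.re) * toC (Z.map Complex.im)⁻¹ * toC (Z.map Complex.re) +
      toC (Z.map Complex.im) := by
  rw [← toC_mul, ← toC_mul]
  ext i j
  simp [toC, imInv]

/-- Both sides equal `X Y⁻¹ X + 2iX - Y`. This identity is what makes the polynomial reproduce
itself under the Fourier transform. -/
lemma mul_im_inv_mul_self {Z : Matrix (Fin n) (Fin n) ℂ} (hZ : Z ∈ upperHalfSpace n) :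
    Z * toC (Z.map Complex.im)⁻¹ * Z = toC (imInv Z) + (2 * Complex.I) • Z := by
  rw [toC_imInv]
  have h1 := toC_im_inv_mul hZ
  have h2 := toC_im_mul_inv hZ
  have hZ' := eq_re_add_im Z
  set X := toC (Z.map Complex.re)
  set Y := toC (Z.map Complex.im)
  set V := toC (Z.map Complex.im)⁻¹
  rw [hZ']
  simp only [Matrix.add_mul, Matrix.mul_add, Matrix.smul_mul, Matrix.mul_smul, h2, Matrix.mul_assoc,
    h1, Matrix.mul_one, Matrix.one_mul, smul_add, smul_smul]
  have hI : 2 * Complex.I * Complex.I = -2 := by rw [mul_assoc, Complex.I_mul_I]; ring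
  rw [hI, Complex.I_mul_I]
  module

/-- The second factor is `Y⁻¹` times the complex conjugate of `Z`. As the right side is real and
invertible, this exhibits `Z⁻¹` with its real and imaginary parts. -/
lemma mul_conj_eq {Z : Matrix (Fin n) (Fin n) ℂ} (hZ : Z ∈ upperHalfSpace n) :
    Z * (toC (Z.map Complex.im)⁻¹ * toC (Z.map Complex.re) - Complex.I • 1) = toC (imInv Z) := by
  rw [toC_imInv]
  have h2 := toC_im_mul_inv hZ
  have hZ' := eq_re_add_im Z
  set X := toC (Z.map Complex.re)
  set Y := toC (Z.map Complex.im)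
  set V := toC (Z.map Complex.im)⁻¹
  rw [hZ', Matrix.mul_sub, Matrix.mul_smul, Matrix.mul_one, Matrix.add_mul, Matrix.smul_mul,
    ← Matrix.mul_assoc, ← Matrix.mul_assoc, h2, Matrix.one_mul, smul_add, smul_smul,
    Complex.I_mul_I]
  module

lemma inv_eq_of_mem {Z : Matrix (Fin n) (Fin n) ℂ} (hZ : Z ∈ upperHalfSpace n) :
    IsUnit Z.det ∧ Z⁻¹ = toC ((Z.map Complex.im)⁻¹ * Z.map Complex.re * (imInv Z)⁻¹) -
      Complex.I • toC (imInv Z)⁻¹ := by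
  have h : Z * (toC ((Z.map Complex.im)⁻¹ * Z.map Complex.re * (imInv Z)⁻¹) -
      Complex.I • toC (imInv Z)⁻¹) = 1 := by
    have h1 := congrArg (fun M => M * toC (imInv Z)⁻¹) (mul_conj_eq hZ)
    rw [← toC_mul (imInv Z), Matrix.mul_nonsing_inv _ (isUnit_det_of_posDef (imInv_posDef hZ)), toC_one,
      Matrix.mul_assoc, Matrix.sub_mul, Matrix.smul_mul, Matrix.one_mul] at h1
    rw [toC_mul, toC_mul]
    exact h1
  exact ⟨Matrix.isUnit_det_of_right_inverse h, Matrix.inv_eq_right_inv h⟩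

lemma im_neg_inv {Z : Matrix (Fin n) (Fin n) ℂ} (hZ : Z ∈ upperHalfSpace n) :
    (-Z⁻¹).map Complex.im = (imInv Z)⁻¹ := by
  rw [(inv_eq_of_mem hZ).2]
  ext i j
  simp [toC]

theorem neg_inv_mem {Z : Matrix (Fin n) (Fin n) ℂ} (hZ : Z ∈ upperHalfSpace n) :
    -Z⁻¹ ∈ upperHalfSpace n := by
  refine ⟨?_, ?_⟩
  · rw [Matrix.IsSymm, Matrix.transpose_neg, Matrix.transpose_nonsing_inv, hZ.1.eq]
  · rw [im_neg_inv hZ]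
    exact (imInv_posDef hZ).inv

lemma inv_kronecker_neg_inv {A : Matrix (Fin m) (Fin m) ℤ} (hA : (toR A).PosDef)
    {Z : Matrix (Fin n) (Fin n) ℂ} (hZ : Z ∈ upperHalfSpace n) :
    (toC (toR A) ⊗ₖ ((-Complex.I) • (-Z⁻¹)))⁻¹ = toC (toR A)⁻¹ ⊗ₖ ((-Complex.I) • Z) := by
  apply Matrix.inv_eq_left_inv
  rw [← Matrix.mul_kronecker_mul, ← toC_mul, Matrix.nonsing_inv_mul _ (isUnit_det_of_posDef hA),
    toC_one, Matrix.smul_mul, Matrix.mul_smul, smul_smul, Matrix.mul_neg,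
    Matrix.mul_nonsing_inv _ (inv_eq_of_mem hZ).1]
  simp

/-- The summand of the theta series at `Z`, as a function on real matrices. -/
def dualTerm (A : Matrix (Fin m) (Fin m) ℤ) (P : MvPolynomial (Fin m × Fin n) ℂ)
    (K : Matrix (Fin m) (Fin n) ℝ) (Z : Matrix (Fin n) (Fin n) ℂ)
    (V : Matrix (Fin m) (Fin n) ℝ) : ℂ :=
  evalR (twistedPoly A P (Z.map Complex.im)) (vec V) *
    gaussian (toC (toR A) ⊗ₖ ((-Complex.I) • Z)) (vec (toR A * K)) (vec V)

lemma gaussian_inv_vec {A : Matrix (Fin m) (Fin m) ℤ} (hA : (toR A).PosDef)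
    (M : Matrix (Fin n) (Fin n) ℂ) (H V : Matrix (Fin m) (Fin n) ℝ) :
    gaussian (toC (toR A)⁻¹ ⊗ₖ M) (vec H) (vec (toR A * V)) =
      gaussian (toC (toR A) ⊗ₖ M) (vec (toR A * H)) (vec V) := by
  have hs := (isSymm_of_posDef hA).eq
  have h1 : ∑ ij, ((vec H ij : ℝ) : ℂ) * (vec (toR A * V) ij : ℝ) =
      ∑ ij, ((vec (toR A * H) ij : ℝ) : ℂ) * (vec V ij : ℝ) := by
    have h2 := dotProduct_vec H (toR A * V)
    have h3 := dotProduct_vec (toR A * H) V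
    rw [Matrix.transpose_mul, hs, Matrix.mul_assoc, ← h2] at h3
    simp only [dotProduct] at h3
    exact_mod_cast h3.symm
  rw [gaussian, gaussian, h1, quadForm_kronecker, quadForm_kronecker, Matrix.transpose_mul, hs,
    Matrix.mul_assoc V.transpose, Matrix.mul_nonsing_inv _ (isUnit_det_of_posDef hA),
    Matrix.mul_one, ← Matrix.mul_assoc]

/-- The heart of the inversion formula: the transformed summand at the dual point `AV` is `(det
Z)^α` times the summand at `V` of the theta series at `Z`. -/
lemma poisson_term_eq {α : ℕ} {A : Matrix (Fin m) (Fin m) ℤ} (hA : (toR A).PosDef)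
    {P : MvPolynomial (Fin m × Fin n) ℂ} (hP : IsDetHomogeneous α P)
    {Z : Matrix (Fin n) (Fin n) ℂ} (hZ : Z ∈ upperHalfSpace n) (H V : Matrix (Fin m) (Fin n) ℝ) :
    evalR (linComp (Complex.I • (toC (toR A)⁻¹ ⊗ₖ ((-Complex.I) • Z)))
      (heat ((4 * Real.pi : ℂ)⁻¹ • (toC (toR A)⁻¹ ⊗ₖ ((-Complex.I) • Z)))
        (twistedPoly A P (imInv Z)⁻¹))) (vec (toR A * V)) *
      gaussian (toC (toR A)⁻¹ ⊗ₖ ((-Complex.I) • Z)) (-vec H) (vec (toR A * V)) =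
    Z.det ^ α * dualTerm A P (-H) Z V := by
  have hpi : (Real.pi : ℂ) ≠ 0 := by exact_mod_cast Real.pi_ne_zero
  have hAs : (toC (toR A)⁻¹).IsSymm := toC_isSymm (isSymm_of_posDef hA.inv)
  have hAi : toC (toR A)⁻¹ = (toC (toR A))⁻¹ := toC_inv (isUnit_det_of_posDef hA)
  have hg : gaussian (toC (toR A)⁻¹ ⊗ₖ ((-Complex.I) • Z)) (-vec H) (vec (toR A * V)) =
      gaussian (toC (toR A) ⊗ₖ ((-Complex.I) • Z)) (vec (toR A * -H)) (vec V) :=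
    gaussian_inv_vec hA _ (-H) V
  -- The factors `i` and `-i` cancel, and so do `A⁻¹` and `A`; the polynomial is evaluated at `VZ`.
  have hv : (Complex.I • (toC (toR A)⁻¹ ⊗ₖ ((-Complex.I) • Z))).mulVec
      (fun ij => ((vec (toR A * V) ij : ℝ) : ℂ)) = vec (toC V * Z) := by
    rw [ofReal_vec, Matrix.kronecker_smul, smul_smul, mul_neg, Complex.I_mul_I, neg_neg, one_smul,
      kronecker_mulVec_vec, ← toC_mul, ← Matrix.mul_assoc,
      Matrix.nonsing_inv_mul _ (isUnit_det_of_posDef hA), Matrix.one_mul, hZ.1.eq]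
  have hs1 : ((4 * Real.pi : ℂ)⁻¹ • (toC (toR A)⁻¹ ⊗ₖ ((-Complex.I) • Z))).IsSymm := by
    refine Matrix.IsSymm.smul (isSymm_kronecker hAs (hZ.1.smul _)) _
  have hs2 : ((-1 / (8 * (Real.pi : ℂ))) • ((toC (toR A))⁻¹ ⊗ₖ toC ((imInv Z)⁻¹)⁻¹)).IsSymm := by
    refine Matrix.IsSymm.smul (isSymm_kronecker (hAi ▸ hAs) (toC_isSymm ?_)) _
    exact isSymm_of_posDef (imInv_posDef hZ).inv.inv
  have hYs : (toC (Z.map Complex.im)⁻¹).IsSymm := toC_isSymm (isSymm_of_posDef hZ.2.inv)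
  -- `(1/4π)(-iZ) = -(1/8π)(2iZ)`, so the two operators combine by `mul_im_inv_mul_self`.
  have hsum : (4 * Real.pi : ℂ)⁻¹ • (toC (toR A)⁻¹ ⊗ₖ ((-Complex.I) • Z)) +
      (-1 / (8 * (Real.pi : ℂ))) • ((toC (toR A))⁻¹ ⊗ₖ toC ((imInv Z)⁻¹)⁻¹) =
      (-1 / (8 * (Real.pi : ℂ))) • ((toC (toR A))⁻¹ ⊗ₖ
        (Z.transpose * toC (Z.map Complex.im)⁻¹ * Z)) := by
    rw [hZ.1.eq, mul_im_inv_mul_self hZ, hAi,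
      Matrix.nonsing_inv_nonsing_inv _ (isUnit_det_of_posDef (imInv_posDef hZ)),
      Matrix.kronecker_add, Matrix.kronecker_smul, Matrix.kronecker_smul, smul_add, smul_smul,
      smul_smul, add_comm]
    congr 2
    field_simp
    ring
  rw [dualTerm, hg, evalR_linComp, hv, twistedPoly, heat_heat hs1 hs2, hsum,
    heat_linComp_kronecker hA hP hYs, mul_assoc]
  rfl

/-- The frequencies of Poisson summation have the form `A V` with `V` in `K + A⁻¹ℤ^{m×n}`. -/
lemma vec_K_add {A : Matrix (Fin m) (Fin m) ℤ} (hA : (toR A).PosDef)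
    (K : Matrix (Fin m) (Fin n) ℝ) (S : Matrix (Fin m) (Fin n) ℤ) :
    vec (toR A * K) + intVec (vec S) = vec (toR A * (K + (toR A)⁻¹ * toR S)) := by
  rw [Matrix.mul_add, ← Matrix.mul_assoc, Matrix.mul_nonsing_inv _ (isUnit_det_of_posDef hA),
    Matrix.one_mul, vec_add, vec_toR]

lemma isCoercive_inv {A : Matrix (Fin m) (Fin m) ℤ} (hA : (toR A).PosDef)
    {Z : Matrix (Fin n) (Fin n) ℂ} (hZ : Z ∈ upperHalfSpace n) :
    IsCoercive (toC (toR A)⁻¹ ⊗ₖ ((-Complex.I) • Z)) :=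
  isCoercive_kronecker hA.inv (by rw [map_re_neg_I_smul]; exact hZ.2)

lemma summable_dualTerm {α : ℕ} {A : Matrix (Fin m) (Fin m) ℤ} (hA : (toR A).PosDef)
    {P : MvPolynomial (Fin m × Fin n) ℂ} (hP : IsDetHomogeneous α P)
    {Z : Matrix (Fin n) (Fin n) ℂ} (hZ : Z ∈ upperHalfSpace n) (H K : Matrix (Fin m) (Fin n) ℝ) :
    Summable fun S : Matrix (Fin m) (Fin n) ℤ =>
      dualTerm A P (-H) Z (K + (toR A)⁻¹ * toR S) := by
  have h := (vecEquiv (m := m) (n := n)).summable_iff.2 ((isCoercive_inv hA hZ).summable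
    (linComp (Complex.I • (toC (toR A)⁻¹ ⊗ₖ ((-Complex.I) • Z)))
      (heat ((4 * Real.pi : ℂ)⁻¹ • (toC (toR A)⁻¹ ⊗ₖ ((-Complex.I) • Z)))
        (twistedPoly A P (imInv Z)⁻¹))) (-vec H) (vec (toR A * K)))
  have h0 : Z.det ^ α ≠ 0 := pow_ne_zero α (inv_eq_of_mem hZ).1.ne_zero
  have h1 : Summable fun S : Matrix (Fin m) (Fin n) ℤ =>
      Z.det ^ α * dualTerm A P (-H) Z (K + (toR A)⁻¹ * toR S) := by
    convert! h using 2 with S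
    rw [← poisson_term_eq hA hP hZ, ← vec_K_add hA]
    rfl
  exact (summable_mul_left_iff h0).1 h1

/-- The inversion formula, before the identification of the Gaussian integral and the grouping
of the dual sum into cosets. -/
theorem theta_neg_inv {α : ℕ} {A : Matrix (Fin m) (Fin m) ℤ} (hA : (toR A).PosDef)
    {P : MvPolynomial (Fin m × Fin n) ℂ} (hP : IsDetHomogeneous α P)
    {Z : Matrix (Fin n) (Fin n) ℂ} (hZ : Z ∈ upperHalfSpace n) (H K : Matrix (Fin m) (Fin n) ℝ) :
    theta (α : ℤ) (modifiedPoly A P) A H K (-Z⁻¹) =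
      gaussInt (toC (toR A) ⊗ₖ ((-Complex.I) • (-Z⁻¹))) *
        e (((H.transpose * toR A * K).trace : ℝ) : ℂ) * Z.det ^ α *
        ∑' S : Matrix (Fin m) (Fin n) ℤ, dualTerm A P (-H) Z (K + (toR A)⁻¹ * toR S) := by
  have hW := neg_inv_mem hZ
  have hinv := inv_kronecker_neg_inv hA hZ
  have hc : character (vec (toR A * K)) (vec H) = e (((H.transpose * toR A * K).trace : ℝ) : ℂ) := by
    have h1 := dotProduct_vec H (toR A * K)
    rw [← Matrix.mul_assoc] at h1
    rw [character, e, ← h1, dotProduct]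
    congr 2
    push_cast
    exact sum_congr rfl fun i _ => mul_comm _ _
  have hp := tsum_evalR_mul_gaussian (isCoercive_of_mem hA hW)
    (isSymm_kronecker (toC_isSymm (isSymm_of_posDef hA)) (hW.1.smul _))
    (by rw [hinv]; exact isCoercive_inv hA hZ)
    (twistedPoly A P (imInv Z)⁻¹) (vec (toR A * K)) (vec H)
  rw [hinv, hc] at hp
  rw [theta_eq_tsum hA hP hW, im_neg_inv hZ]
  refine ((vecEquiv (m := m) (n := n)).tsum_eq _).trans (hp.trans ?_)
  rw [mul_assoc _ (Z.det ^ α), ← tsum_mul_left (a := Z.det ^ α),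
    ← (vecEquiv (m := m) (n := n)).tsum_eq]
  congr 1
  refine tsum_congr fun S => ?_
  rw [← poisson_term_eq hA hP hZ, ← vec_K_add hA]
  rfl

lemma toR_mul {k l r : ℕ} (B : Matrix (Fin k) (Fin l) ℤ) (C : Matrix (Fin l) (Fin r) ℤ) :
    toR (B * C) = toR B * toR C := Matrix.map_mul (f := Int.castRingHom ℝ)

lemma toR_injective {k l : ℕ} :
    Function.Injective (toR : Matrix (Fin k) (Fin l) ℤ → Matrix (Fin k) (Fin l) ℝ) := by
  intro B C h
  ext i j
  have := congrFun (congrFun h i) j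
  simpa [toR] using this

lemma toR_add {k l : ℕ} (B C : Matrix (Fin k) (Fin l) ℤ) : toR (B + C) = toR B + toR C := by
  ext i j; simp [toR]

lemma toR_sub {k l : ℕ} (B C : Matrix (Fin k) (Fin l) ℤ) : toR (B - C) = toR B - toR C := by
  ext i j; simp [toR]

lemma toR_zero {k l : ℕ} : toR (0 : Matrix (Fin k) (Fin l) ℤ) = 0 := by
  ext i j; simp [toR]

lemma inv_mul_toR_mul {A : Matrix (Fin m) (Fin m) ℤ} (hA : (toR A).PosDef)
    (T : Matrix (Fin m) (Fin n) ℤ) : (toR A)⁻¹ * toR (A * T) = toR T := by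
  rw [toR_mul, ← Matrix.mul_assoc, Matrix.nonsing_inv_mul _ (isUnit_det_of_posDef hA),
    Matrix.one_mul]

/-- Every integer matrix is uniquely `A J + A R` with `J` in the system and `R` integral;
summability allows the regrouping. -/
lemma tsum_eq_sum_isRepSystem {A : Matrix (Fin m) (Fin m) ℤ} (hA : (toR A).PosDef)
    {𝒥 : Finset (Matrix (Fin m) (Fin n) ℝ)} (h𝒥 : IsRepSystem A 𝒥)
    {T : Matrix (Fin m) (Fin n) ℝ → ℂ} {K : Matrix (Fin m) (Fin n) ℝ}
    (hT : Summable fun S : Matrix (Fin m) (Fin n) ℤ => T (K + (toR A)⁻¹ * toR S)) :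
    ∑' S : Matrix (Fin m) (Fin n) ℤ, T (K + (toR A)⁻¹ * toR S) =
      ∑ J ∈ 𝒥, ∑' R : Matrix (Fin m) (Fin n) ℤ, T (J + K + toR R) := by
  choose ρ hρ using h𝒥.1
  let f : 𝒥 × Matrix (Fin m) (Fin n) ℤ → Matrix (Fin m) (Fin n) ℤ :=
    fun x => ρ x.1.1 x.1.2 + A * x.2
  have hf : ∀ x, (toR A)⁻¹ * toR (f x) = x.1.1 + toR x.2 := by
    intro x
    rw [toR_add, Matrix.mul_add, inv_mul_toR_mul hA, ← hρ]
  have hbij : Function.Bijective f := by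
    constructor
    · rintro ⟨⟨J, hJ⟩, R⟩ ⟨⟨J', hJ'⟩, R'⟩ h
      have h1 := hf ⟨⟨J, hJ⟩, R⟩
      have h2 := hf ⟨⟨J', hJ'⟩, R'⟩
      simp only at h1 h2
      obtain rfl : J = J' := (h𝒥.2 (f ⟨⟨J, hJ⟩, R⟩)).unique
        ⟨hJ, R, by rw [h1, add_sub_cancel_left]⟩ ⟨hJ', R', by rw [h, h2, add_sub_cancel_left]⟩
      rw [h, h2] at h1
      have := toR_injective (add_left_cancel h1)
      rw [this]
    · intro S
      obtain ⟨J, ⟨hJ, R, hR⟩, -⟩ := h𝒥.2 S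
      refine ⟨⟨⟨J, hJ⟩, R⟩, toR_injective ?_⟩
      have h1 := hf ⟨⟨J, hJ⟩, R⟩
      rw [← hR, add_sub_cancel] at h1
      have h2 := congrArg (fun M => toR A * M) h1
      simpa only [← Matrix.mul_assoc, Matrix.mul_nonsing_inv _ (isUnit_det_of_posDef hA),
        Matrix.one_mul] using h2
  let E := Equiv.ofBijective f hbij
  have hterm : ∀ x, T (K + (toR A)⁻¹ * toR (E x)) = T (x.1.1 + K + toR x.2) := by
    intro x
    change T (K + (toR A)⁻¹ * toR (f x)) = _
    rw [hf, add_left_comm, add_assoc]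
  rw [← E.tsum_eq]
  have hsum := E.summable_iff.2 hT
  simp only [Function.comp_def, hterm] at hsum ⊢
  rw [hsum.tsum_prod, tsum_fintype]
  exact Finset.sum_coe_sort 𝒥 fun J => ∑' R : Matrix (Fin m) (Fin n) ℤ, T (J + K + toR R)

/-- By the adjugate, `det A · ℤ^{m×n}` lies in `A ℤ^{m×n}`. Each class is therefore met by a matrix
with entries reduced modulo `det A`, and these are finite in number. -/
theorem exists_isRepSystem {A : Matrix (Fin m) (Fin m) ℤ} (hA : (toR A).PosDef) :
    ∃ 𝒥 : Finset (Matrix (Fin m) (Fin n) ℝ), IsRepSystem A 𝒥 := by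
  classical
  have hdet : A.det ≠ 0 := by
    intro h
    have h1 : (toR A).det = ((A.det : ℤ) : ℝ) := ((Int.castRingHom ℝ).map_det A).symm
    have := hA.det_pos
    rw [h1, h] at this
    simp at this
  let s : Setoid (Matrix (Fin m) (Fin n) ℤ) :=
    { r := fun R S => ∃ T : Matrix (Fin m) (Fin n) ℤ, R - S = A * T
      iseqv := ⟨fun R => ⟨0, by simp⟩, fun ⟨T, hT⟩ => ⟨-T, by rw [Matrix.mul_neg, ← hT, neg_sub]⟩,
        fun ⟨T, hT⟩ ⟨T', hT'⟩ => ⟨T + T', by rw [Matrix.mul_add, ← hT, ← hT']; abel⟩⟩ }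
  let rep : Matrix (Fin m) (Fin n) ℤ → Matrix (Fin m) (Fin n) ℤ := fun R => (Quotient.mk s R).out
  have hrep : ∀ R, ∃ T : Matrix (Fin m) (Fin n) ℤ, R - rep R = A * T := fun R =>
    Quotient.exact (s := s) (Quotient.out_eq (Quotient.mk s R)).symm
  have hrep' : ∀ R S, (∃ T : Matrix (Fin m) (Fin n) ℤ, R - S = A * T) → rep R = rep S := by
    intro R S h
    have : Quotient.mk s R = Quotient.mk s S := Quotient.sound h
    simp only [rep, this]
  have hfin : (Set.range rep).Finite := by
    refine Set.Finite.subset (s := rep '' {R | ∀ i j, R i j ∈ Set.Icc 0 |A.det|}) ?_ ?_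
    · refine Set.Finite.image _ ?_
      have := Set.Finite.pi' fun _ : Fin m => Set.Finite.pi' fun _ : Fin n =>
        Set.finite_Icc (0 : ℤ) |A.det|
      exact this
    · rintro _ ⟨R, rfl⟩
      refine ⟨R.map fun a => a % A.det, fun i j => ?_, ?_⟩
      · exact ⟨Int.emod_nonneg _ hdet, (Int.emod_lt_abs _ hdet).le⟩
      -- Reduced minus original is `-det A` times the quotient, and `det A = A · adj A`; hence the
      -- minus sign in the witness.
      · refine hrep' _ _ ⟨A.adjugate * -(R.map fun a => a / A.det), ?_⟩
        rw [← Matrix.mul_assoc, Matrix.mul_adjugate]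
        ext i j
        simp only [Matrix.sub_apply, Matrix.map_apply, Matrix.smul_mul, Matrix.one_mul,
          Matrix.smul_apply, Matrix.neg_apply, smul_eq_mul]
        have := Int.emod_add_mul_ediv (R i j) A.det
        linarith
  refine ⟨(hfin.image fun R => (toR A)⁻¹ * toR R).toFinset, ?_, ?_⟩
  · intro J hJ
    rw [Set.Finite.mem_toFinset] at hJ
    obtain ⟨R, -, rfl⟩ := hJ
    exact ⟨R, rfl⟩
  · intro R
    obtain ⟨T, hT⟩ := hrep R
    refine ⟨(toR A)⁻¹ * toR (rep R), ⟨?_, T, ?_⟩, ?_⟩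
    · rw [Set.Finite.mem_toFinset]
      exact ⟨rep R, ⟨R, rfl⟩, rfl⟩
    · rw [← Matrix.mul_sub, ← toR_sub, hT, inv_mul_toR_mul hA]
    · rintro J ⟨hJ, T', hT'⟩
      rw [Set.Finite.mem_toFinset] at hJ
      obtain ⟨_, ⟨S, rfl⟩, rfl⟩ := hJ
      simp only at hT' ⊢
      have h1 : R - rep S = A * T' := by
        apply toR_injective
        have h2 := congrArg (fun M => toR A * M) hT'
        simp only [Matrix.mul_sub, ← Matrix.mul_assoc,
          Matrix.mul_nonsing_inv _ (isUnit_det_of_posDef hA), Matrix.one_mul] at h2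
        rw [toR_sub, h2, toR_mul]
      obtain ⟨T'', hT''⟩ := hrep S
      have h3 : rep R = rep S := by
        refine hrep' _ _ ⟨T' - T'', ?_⟩
        rw [Matrix.mul_sub, ← h1, ← hT'']
        abel
      rw [h3]

end Inversion

open MvPolynomial Finset MeasureTheory Filter Topology
open scoped Kronecker

/-! ### The branch of the square root of `det Z` and the transformation formula -/

section Branch

variable {m n : ℕ}

lemma convex_upperHalfSpace : Convex ℝ (upperHalfSpace n) := by
  intro Z hZ W hW a b ha hb hab
  refine ⟨(hZ.1.smul a).add (hW.1.smul b), ?_⟩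
  have h : (a • Z + b • W).map Complex.im = a • Z.map Complex.im + b • W.map Complex.im := by
    ext i j; simp
  rw [h]
  rcases ha.eq_or_lt with rfl | ha'
  · have : b = 1 := by linarith
    subst this
    simpa using hW.2
  · exact (hZ.2.smul ha').add_posSemidef (hW.2.posSemidef.smul hb)

lemma isPreconnected_upperHalfSpace : IsPreconnected (upperHalfSpace n) :=
  convex_upperHalfSpace.isPreconnected

lemma I_smul_one_mem : Complex.I • (1 : Matrix (Fin n) (Fin n) ℂ) ∈ upperHalfSpace n := by
  refine ⟨Matrix.isSymm_one.smul _, ?_⟩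
  have : (Complex.I • (1 : Matrix (Fin n) (Fin n) ℂ)).map Complex.im = 1 := by
    ext i j
    rcases eq_or_ne i j with rfl | h
    · simp
    · simp [h]
  rw [this]
  exact Matrix.PosDef.one

lemma det_ne_zero_of_mem {Z : Matrix (Fin n) (Fin n) ℂ} (hZ : Z ∈ upperHalfSpace n) :
    Z.det ≠ 0 := (inv_eq_of_mem hZ).1.ne_zero

lemma neg_I_smul_I_smul_one :
    (-Complex.I) • (Complex.I • (1 : Matrix (Fin n) (Fin n) ℂ)) = 1 := by
  rw [smul_smul, neg_mul, Complex.I_mul_I, neg_neg, one_smul]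

lemma isCoercive_neg_I_smul {Z : Matrix (Fin n) (Fin n) ℂ} (hZ : Z ∈ upperHalfSpace n) :
    IsCoercive ((-Complex.I) • Z) :=
  isCoercive_of_posDef (by rw [map_re_neg_I_smul]; exact hZ.2)

lemma I_cpow_half_pow (n k : ℕ) :
    (Complex.I ^ ((n : ℂ) / 2)) ^ (2 * k) = Complex.I ^ (n * k) := by
  rw [← Complex.cpow_nat_mul]
  have : ((2 * k : ℕ) : ℂ) * ((n : ℂ) / 2) = ((n * k : ℕ) : ℂ) := by push_cast; ring
  rw [this, Complex.cpow_natCast]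

/-- The Gaussian integral of `-iZ` is a continuous, nowhere zero square root of `1 / det(-iZ)` that
equals `1` at `iI`, so the branch can be written down from it. -/
theorem exists_isDetRoot (n : ℕ) : ∃ r : Matrix (Fin n) (Fin n) ℂ → ℂ, IsDetRoot n r := by
  have hne : ∀ Z ∈ upperHalfSpace n, gaussInt ((-Complex.I) • Z) ≠ 0 := by
    intro Z hZ h0
    have := (isCoercive_neg_I_smul hZ).gaussInt_sq_mul_det (hZ.1.smul _)
    rw [h0] at this
    simp at this
  refine ⟨fun Z => Complex.I ^ ((n : ℂ) / 2) / gaussInt ((-Complex.I) • Z), ?_, ?_, ?_⟩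
  · refine ContinuousOn.div continuousOn_const (fun Z hZ => ?_) hne
    refine ContinuousAt.continuousWithinAt ?_
    exact ContinuousAt.comp (g := gaussInt) (isCoercive_neg_I_smul hZ).continuousAt_gaussInt
      (by fun_prop)
  · intro Z hZ
    have h := (isCoercive_neg_I_smul hZ).gaussInt_sq_mul_det (hZ.1.smul _)
    have h0 := hne Z hZ
    rw [Matrix.det_smul, Fintype.card_fin] at h
    have hI := I_cpow_half_pow n 1
    rw [mul_one, mul_one] at hI
    have hI2 : Complex.I ^ n * (-Complex.I) ^ n = 1 := by
      rw [← mul_pow, mul_neg, Complex.I_mul_I, neg_neg, one_pow]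
    simp only
    rw [div_pow, hI, div_eq_iff (pow_ne_zero 2 h0)]
    linear_combination (-Complex.I ^ n) * h + (gaussInt ((-Complex.I) • Z)) ^ 2 * Z.det * hI2
  · simp only [neg_I_smul_I_smul_one]
    have h1 : (1 : Matrix (Fin n) (Fin n) ℂ) = (1 : Matrix (Fin n) (Fin n) ℝ).map Complex.ofReal :=
      toC_one.symm
    have hc : IsCoercive (1 : Matrix (Fin n) (Fin n) ℂ) := by
      have := isCoercive_neg_I_smul (I_smul_one_mem (n := n))
      rwa [neg_I_smul_I_smul_one] at this
    obtain ⟨t, ht, h⟩ := IsCoercive.gaussInt_ofReal (h1 ▸ hc)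
    rw [← h1] at h
    have h2 := hc.gaussInt_sq_mul_det Matrix.isSymm_one
    rw [h, Matrix.det_one, mul_one] at h2
    have h3 : t ^ 2 = 1 := by exact_mod_cast h2
    have h4 : t = 1 := by
      rwa [pow_eq_one_iff_of_nonneg ht.le two_ne_zero] at h3
    rw [h, h4]
    simp

lemma IsDetRoot.ne_zero {r : Matrix (Fin n) (Fin n) ℂ → ℂ} (hr : IsDetRoot n r)
    {Z : Matrix (Fin n) (Fin n) ℂ} (hZ : Z ∈ upperHalfSpace n) : r Z ≠ 0 := by
  intro h
  have := hr.2.1 Z hZ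
  rw [h] at this
  exact det_ne_zero_of_mem hZ (by simpa using this.symm)

lemma continuousOn_neg_inv :
    ContinuousOn (fun Z : Matrix (Fin n) (Fin n) ℂ => -Z⁻¹) (upperHalfSpace n) := by
  have h : (fun Z : Matrix (Fin n) (Fin n) ℂ => -Z⁻¹) =
      fun Z => -((Z.det)⁻¹ • Z.adjugate) := by
    funext Z
    rw [Matrix.inv_def, Ring.inverse_eq_inv']
  rw [h]
  refine ContinuousOn.neg (ContinuousOn.smul (ContinuousOn.inv₀ ?_ fun Z hZ =>
    det_ne_zero_of_mem hZ) ?_)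
  · exact (continuous_id.matrix_det).continuousOn
  · exact (continuous_id.matrix_adjugate).continuousOn

lemma continuous_kronecker_left (A : Matrix (Fin m) (Fin m) ℂ) :
    Continuous fun M : Matrix (Fin n) (Fin n) ℂ => A ⊗ₖ M := by
  refine continuous_pi fun i => continuous_pi fun j => ?_
  change Continuous fun M : Matrix (Fin n) (Fin n) ℂ => A i.1 j.1 * M i.2 j.2
  fun_prop

lemma I_cpow_ne_zero (s : ℂ) : Complex.I ^ s ≠ 0 := by
  simp [Complex.cpow_eq_zero_iff]

/-- Both sides are continuous on a connected set and have the same square, and the right side never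
vanishes. Hence agreement at one point suffices. -/
theorem gaussInt_kronecker_neg_inv {A : Matrix (Fin m) (Fin m) ℤ} (hA : (toR A).PosDef)
    {r : Matrix (Fin n) (Fin n) ℂ → ℂ} (hr : IsDetRoot n r)
    {Z : Matrix (Fin n) (Fin n) ℂ} (hZ : Z ∈ upperHalfSpace n) :
    gaussInt (toC (toR A) ⊗ₖ ((-Complex.I) • (-Z⁻¹))) =
      Complex.I ^ (-((m : ℂ) * (n : ℂ)) / 2) *
        (((toR A).det ^ (-(n : ℝ) / 2) : ℝ) : ℂ) * r Z ^ m := by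
  have hdetA := hA.det_pos
  have hs : ∀ {W : Matrix (Fin n) (Fin n) ℂ}, W ∈ upperHalfSpace n →
      (toC (toR A) ⊗ₖ ((-Complex.I) • W)).IsSymm := fun hW =>
    isSymm_kronecker (toC_isSymm (isSymm_of_posDef hA)) (hW.1.smul _)
  have hdetpow : (((toR A).det ^ (-(n : ℝ) / 2) : ℝ) : ℂ) ^ 2 * ((toR A).det : ℂ) ^ n = 1 := by
    rw [← Complex.ofReal_pow, ← Complex.ofReal_pow, ← Complex.ofReal_mul, ← Real.rpow_natCast,
      ← Real.rpow_natCast, ← Real.rpow_mul hdetA.le, ← Real.rpow_add hdetA]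
    have : -(n : ℝ) / 2 * (2 : ℕ) + n = 0 := by push_cast; ring
    rw [this, Real.rpow_zero, Complex.ofReal_one]
  have hIpow : (Complex.I ^ (-((m : ℂ) * (n : ℂ)) / 2)) ^ 2 * Complex.I ^ (n * m) = 1 := by
    rw [← Complex.cpow_natCast Complex.I, ← Complex.cpow_nat_mul,
      ← Complex.cpow_add _ _ Complex.I_ne_zero]
    have : ((2 : ℕ) : ℂ) * (-((m : ℂ) * (n : ℂ)) / 2) + ((n * m : ℕ) : ℂ) = 0 := by
      push_cast; ring
    rw [this, Complex.cpow_zero]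
  refine isPreconnected_upperHalfSpace.eq_of_sq_eq
    (f := fun Z => gaussInt (toC (toR A) ⊗ₖ ((-Complex.I) • (-Z⁻¹))))
    (g := fun Z => Complex.I ^ (-((m : ℂ) * (n : ℂ)) / 2) *
        (((toR A).det ^ (-(n : ℝ) / 2) : ℝ) : ℂ) * r Z ^ m)
    ?_ ?_ ?_ ?_ (I_smul_one_mem (n := n)) ?_ hZ
  · intro W hW
    refine ContinuousAt.comp_continuousWithinAt (g := gaussInt)
      (isCoercive_of_mem hA (neg_inv_mem hW)).continuousAt_gaussInt ?_
    exact (continuous_kronecker_left _).continuousAt.comp_continuousWithinAt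
      ((continuousOn_neg_inv W hW).const_smul (-Complex.I))
  · exact continuousOn_const.mul (hr.1.pow m)
  · intro W hW
    have h := (isCoercive_of_mem hA (neg_inv_mem hW)).gaussInt_sq_mul_det
      (hs (neg_inv_mem hW))
    have hd : (toC (toR A) ⊗ₖ ((-Complex.I) • (-W⁻¹))).det =
        ((toR A).det : ℂ) ^ n * (Complex.I ^ n * (W.det)⁻¹) ^ m := by
      rw [Matrix.det_kronecker, toC_det, Fintype.card_fin, Fintype.card_fin, neg_smul_neg,
        Matrix.det_smul, Matrix.det_nonsing_inv, Ring.inverse_eq_inv', Fintype.card_fin]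
    rw [hd] at h
    have hW0 := det_ne_zero_of_mem hW
    have hr2 := hr.2.1 W hW
    simp only [Pi.pow_apply, mul_pow]
    rw [← pow_mul, mul_comm m 2, pow_mul, hr2]
    rw [mul_pow, ← pow_mul, inv_pow] at h
    have hWm : (W.det ^ m)⁻¹ * W.det ^ m = 1 := inv_mul_cancel₀ (pow_ne_zero _ hW0)
    -- With the powers turned into atoms, equality of the squares is polynomial algebra from `h` and
    -- the relations `hdetpow`, `hIpow`, `hWm`.
    generalize gaussInt (toC (toR A) ⊗ₖ ((-Complex.I) • (-W⁻¹))) = g at *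
    generalize (Complex.I ^ (-((m : ℂ) * (n : ℂ)) / 2)) = a at *
    generalize (((toR A).det ^ (-(n : ℝ) / 2) : ℝ) : ℂ) = b at *
    generalize ((toR A).det : ℂ) ^ n = c at *
    generalize Complex.I ^ (n * m) = d at *
    generalize (W.det ^ m)⁻¹ = w' at *
    generalize W.det ^ m = w at *
    have e1 : g ^ 2 * (b ^ 2 * c) * (a ^ 2 * d) * (w' * w) = a ^ 2 * b ^ 2 * w := by
      linear_combination (a ^ 2 * b ^ 2 * w) * h
    rw [hdetpow, hIpow, hWm] at e1
    linear_combination e1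
  · intro W hW
    refine mul_ne_zero (mul_ne_zero (I_cpow_ne_zero _) ?_) (pow_ne_zero _ (hr.ne_zero hW))
    exact Complex.ofReal_ne_zero.2 (Real.rpow_pos_of_pos hdetA _).ne'
  -- At the fixed point `iI` the form is the real matrix `A ⊗ 1`, so the integral is the positive
  -- root.
  · have hinv : -(Complex.I • (1 : Matrix (Fin n) (Fin n) ℂ))⁻¹ = Complex.I • 1 := by
      rw [neg_eq_iff_eq_neg]
      apply Matrix.inv_eq_right_inv
      rw [Matrix.mul_neg, Matrix.smul_mul, Matrix.mul_smul, Matrix.one_mul, smul_smul,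
        Complex.I_mul_I, neg_one_smul, neg_neg]
    simp only [hinv, neg_I_smul_I_smul_one, hr.2.2]
    have hK : toC (toR A) ⊗ₖ (1 : Matrix (Fin n) (Fin n) ℂ) =
        (toR A ⊗ₖ (1 : Matrix (Fin n) (Fin n) ℝ)).map Complex.ofReal := by
      ext i j
      simp only [Matrix.kroneckerMap_apply, Matrix.map_apply, toC, Matrix.one_apply]
      split_ifs <;> simp
    have hc := isCoercive_of_mem hA (I_smul_one_mem (n := n))
    have hs1 := hs (I_smul_one_mem (n := n))
    rw [neg_I_smul_I_smul_one] at hc hs1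
    obtain ⟨t, ht, h⟩ := IsCoercive.gaussInt_ofReal (hK ▸ hc)
    rw [← hK] at h
    have h2 := hc.gaussInt_sq_mul_det hs1
    rw [h, Matrix.det_kronecker, Matrix.det_one, one_pow, mul_one, toC_det, Fintype.card_fin] at h2
    have h3 : ((t : ℂ)) = (((toR A).det ^ (-(n : ℝ) / 2) : ℝ) : ℂ) := by
      have hp := Real.rpow_pos_of_pos hdetA (-(n : ℝ) / 2)
      have hd0 : ((toR A).det : ℂ) ^ n ≠ 0 :=
        pow_ne_zero _ (Complex.ofReal_ne_zero.2 hdetA.ne')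
      have h4 := mul_right_cancel₀ hd0 (h2.trans hdetpow.symm)
      have h5 : t ^ 2 = ((toR A).det ^ (-(n : ℝ) / 2)) ^ 2 := by exact_mod_cast h4
      rw [(pow_left_inj₀ ht.le hp.le two_ne_zero).1 h5]
    have hI1 : Complex.I ^ (-((m : ℂ) * (n : ℂ)) / 2) * (Complex.I ^ ((n : ℂ) / 2)) ^ m = 1 := by
      rw [← Complex.cpow_nat_mul, ← Complex.cpow_add _ _ Complex.I_ne_zero]
      have : -((m : ℂ) * (n : ℂ)) / 2 + (m : ℂ) * ((n : ℂ) / 2) = 0 := by ring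
      rw [this, Complex.cpow_zero]
    rw [h, h3]
    linear_combination -(((toR A).det ^ (-(n : ℝ) / 2) : ℝ) : ℂ) * hI1

/-- For even `m` the exponent is a natural number. For `n = 1` the determinant has positive
imaginary part, so the principal root is continuous and agrees with the branch at `i`. -/
theorem isDetRoot_pow_eq_cpow {α : ℕ} {r : Matrix (Fin n) (Fin n) ℂ → ℂ} (hr : IsDetRoot n r)
    (h : Even m ∨ n = 1) {Z : Matrix (Fin n) (Fin n) ℂ} (hZ : Z ∈ upperHalfSpace n) :
    r Z ^ (m + 2 * α) = Z.det ^ ((m : ℂ) / 2 + (α : ℂ)) := by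
  rcases h with ⟨k, rfl⟩ | rfl
  · have : ((k + k : ℕ) : ℂ) / 2 + (α : ℂ) = ((k + α : ℕ) : ℂ) := by push_cast; ring
    rw [this, Complex.cpow_natCast, ← hr.2.1 Z hZ, ← pow_mul]
    congr 1
    ring
  · have hslit : ∀ W ∈ upperHalfSpace 1, W.det ∈ Complex.slitPlane := by
      intro W hW
      right
      have := hW.2.det_pos
      rw [Matrix.det_fin_one, Matrix.map_apply] at this
      rw [Matrix.det_fin_one]
      exact this.ne'
    have hroot : r Z = Z.det ^ (1 / 2 : ℂ) := by
      refine isPreconnected_upperHalfSpace.eq_of_sq_eq (f := r)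
        (g := fun W => W.det ^ (1 / 2 : ℂ)) hr.1 ?_ ?_ ?_ (I_smul_one_mem (n := 1)) ?_ hZ
      · intro W hW
        have : ContinuousAt (fun z : ℂ => z ^ (1 / 2 : ℂ)) W.det :=
          continuousAt_cpow_const (hslit W hW)
        exact (this.comp (f := fun W : Matrix (Fin 1) (Fin 1) ℂ => W.det)
          (continuous_id.matrix_det).continuousAt).continuousWithinAt
      · intro W hW
        simp only [Pi.pow_apply]
        rw [hr.2.1 W hW, ← Complex.cpow_nat_mul]
        simp
      · intro W hW
        rw [Ne, Complex.cpow_eq_zero_iff]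
        exact fun h => det_ne_zero_of_mem hW h.1
      · rw [hr.2.2]
        simp
    rw [hroot, ← Complex.cpow_nat_mul]
    congr 1
    push_cast
    ring

/-- The power of `r Z` has two sources: `m` from the Gaussian integral, and `2α` from `(det Z)^α` in
the polynomial. -/
theorem theta_transformation {α : ℕ} {A : Matrix (Fin m) (Fin m) ℤ} (hA : (toR A).PosDef)
    {P : MvPolynomial (Fin m × Fin n) ℂ} (hP : IsDetHomogeneous α P)
    {r : Matrix (Fin n) (Fin n) ℂ → ℂ} (hr : IsDetRoot n r)
    {𝒥 : Finset (Matrix (Fin m) (Fin n) ℝ)} (h𝒥 : IsRepSystem A 𝒥)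
    (H K : Matrix (Fin m) (Fin n) ℝ)
    {Z : Matrix (Fin n) (Fin n) ℂ} (hZ : Z ∈ upperHalfSpace n) :
    theta (α : ℤ) (modifiedPoly A P) A H K (-Z⁻¹) =
      Complex.I ^ (-((m : ℂ) * (n : ℂ)) / 2) * (((toR A).det ^ (-(n : ℝ) / 2) : ℝ) : ℂ) *
        r Z ^ (m + 2 * α) * e (((H.transpose * toR A * K).trace : ℝ) : ℂ) *
        ∑ J ∈ 𝒥, theta (α : ℤ) (modifiedPoly A P) A (J + K) (-H) Z := by
  rw [theta_neg_inv hA hP hZ, gaussInt_kronecker_neg_inv hA hr hZ,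
    tsum_eq_sum_isRepSystem hA h𝒥 (summable_dualTerm hA hP hZ H K), ← hr.2.1 Z hZ, pow_add, pow_mul]
  have h : ∀ J, theta (α : ℤ) (modifiedPoly A P) A (J + K) (-H) Z =
      ∑' R : Matrix (Fin m) (Fin n) ℤ, dualTerm A P (-H) Z (J + K + toR R) :=
    fun J => theta_eq_tsum hA hP hZ _ _
  simp only [h]
  ring

end Branch

open MvPolynomial Finset MeasureTheory Filter Topology
open scoped Kronecker

/-! ### Termwise complex differentiation -/

section Holomorphy

variable {ι : Type*} [Fintype ι]

/-- A theta series with polynomial coefficients is holomorphic in linear parameters of the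
quadratic form. -/
theorem differentiableAt_tsum_gaussian {E : Type*} [NormedAddCommGroup E] [NormedSpace ℂ E]
    [NormedSpace ℝ E] (b : ι → ι → E →L[ℂ] ℂ) (p : MvPolynomial ι ℂ) (v h : ι → ℝ) {Z₀ : E}
    (hB : IsCoercive (Matrix.of fun i j => b i j Z₀)) :
    DifferentiableAt ℂ (fun Z => ∑' R : ι → ℤ, evalR p (h + intVec R) *
      gaussian (Matrix.of fun i j => b i j Z) v (h + intVec R)) Z₀ := by
  -- Differentiating the Gaussian in its form brings down `-π x_i x_j`, so the bounds are needed for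
  -- `X_i X_j p`.
  choose C hC0 hC using fun ij : ι × ι => hB.exists_eventually_norm_le (X ij.1 * (X ij.2 * p))
  have hcont : Continuous fun Z : E => (Matrix.of fun i j => b i j Z : Matrix ι ι ℂ) :=
    continuous_pi fun i => continuous_pi fun j => (b i j).continuous
  have hev : ∀ᶠ Z in 𝓝 Z₀, ∀ ij : ι × ι, ∀ v x : ι → ℝ,
      ‖evalR (X ij.1 * (X ij.2 * p)) x * gaussian (Matrix.of fun i j => b i j Z) v x‖ ≤
        C ij * decay x :=
    eventually_all.2 fun ij => hcont.continuousAt.eventually (hC ij)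
  obtain ⟨δ, hδ, hball⟩ := Metric.eventually_nhds_iff_ball.1 hev
  let L : (ι → ℝ) → E →L[ℂ] ℂ := fun x => ∑ i, ∑ j, (-(Real.pi : ℂ) * (x i * x j)) • b i j
  have hderiv : ∀ (x : ι → ℝ) (Z : E),
      HasFDerivAt (fun Z => evalR p x * gaussian (Matrix.of fun i j => b i j Z) v x)
        ((evalR p x * gaussian (Matrix.of fun i j => b i j Z) v x) • L x) Z := by
    intro x Z
    have h1 : ∀ Z, -(Real.pi : ℂ) * quadForm (Matrix.of fun i j => b i j Z) x = L x Z := by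
      intro Z
      simp only [quadForm, L, mul_sum, _root_.sum_apply, _root_.smul_apply, smul_eq_mul, Matrix.of_apply]
      exact sum_congr rfl fun i _ => sum_congr rfl fun j _ => by ring
    have h2 := (((L x).hasFDerivAt (x := Z)).add_const
      (2 * Real.pi * Complex.I * ∑ i, (v i : ℂ) * x i)).cexp.const_mul (evalR p x)
    convert! h2 using 1
    · funext Z
      rw [gaussian, h1]
    · rw [gaussian, h1, smul_smul]
  refine (hasFDerivAt_tsum_of_isPreconnected (𝕜 := ℂ)
    (f' := fun (R : ι → ℤ) Z => (evalR p (h + intVec R) *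
      gaussian (Matrix.of fun i j => b i j Z) v (h + intVec R)) • L (h + intVec R))
    (u := fun R : ι → ℤ => ∑ i, ∑ j, Real.pi * ‖b i j‖ * (C (i, j) * decay (h + intVec R)))
    ?_ Metric.isOpen_ball (convex_ball Z₀ δ).isPreconnected
    (fun R Z _ => hderiv (h + intVec R) Z) ?_ (Metric.mem_ball_self hδ)
    (hB.summable p v h) (Metric.mem_ball_self hδ)).differentiableAt
  · refine summable_sum fun i _ => summable_sum fun j _ => ?_
    exact ((summable_decay h).mul_left _).mul_left _
  · intro R Z hZ
    set x := h + intVec R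
    set g := evalR p x * gaussian (Matrix.of fun i j => b i j Z) v x with hg
    have h3 : g • L x = ∑ i, ∑ j, (g * (-(Real.pi : ℂ) * (x i * x j))) • b i j := by
      simp only [L, smul_sum, smul_smul]
    rw [h3]
    refine (norm_sum_le _ _).trans (sum_le_sum fun i _ => (norm_sum_le _ _).trans
      (sum_le_sum fun j _ => ?_))
    have h4 := hball Z hZ (i, j) v x
    rw [evalR_X_mul, evalR_X_mul] at h4
    have h5 : g * (-(Real.pi : ℂ) * (x i * x j)) =
        -(Real.pi : ℂ) * (x i * (x j * evalR p x) *
          gaussian (Matrix.of fun i j => b i j Z) v x) := by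
      rw [hg]; ring
    rw [norm_smul, h5, norm_mul, norm_neg, Complex.norm_real, Real.norm_eq_abs,
      abs_of_pos Real.pi_pos, mul_right_comm]
    exact mul_le_mul_of_nonneg_left h4 (by positivity)

end Holomorphy

/-! ### Polynomials killed by `tr Δ_A` -/

section Harmonic

variable {m n : ℕ}

lemma modifiedPoly_of_harmonic {A : Matrix (Fin m) (Fin m) ℤ}
    {P : MvPolynomial (Fin m × Fin n) ℂ} (h : trLaplace A P = 0)
    (U : Matrix (Fin m) (Fin n) ℝ) : modifiedPoly A P U = evalMatrix P (toC U) := by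
  rw [modifiedPoly, expTrLaplace_eq_heat, heat_of_quadDiff_eq_zero]
  rw [quadDiff_smul, LinearMap.smul_apply, ← trLaplace_eq_quadDiff, h, smul_zero]

/-- The hypothesis concerns `A⁻¹ ⊗ 1`, the operator here `A⁻¹ ⊗ Y⁻¹`. Two evaluations of the
modified polynomial at `U Y^{1/2}`, by homogeneity and by `modifiedPoly_mul_sqrt`, differ only in
the factor sought, and the power of `det Y` cancels. -/
lemma evalR_twistedPoly_of_harmonic {α : ℕ} {A : Matrix (Fin m) (Fin m) ℤ} (hA : (toR A).PosDef)
    {P : MvPolynomial (Fin m × Fin n) ℂ} (hP : IsDetHomogeneous α P) (h : trLaplace A P = 0)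
    {Y : Matrix (Fin n) (Fin n) ℝ} (hY : Y.PosDef) (U : Matrix (Fin m) (Fin n) ℝ) :
    evalR (twistedPoly A P Y) (vec U) = evalR P (vec U) := by
  have h1 := modifiedPoly_mul_sqrt hA hP hY U
  have hdet : (CFC.sqrt Y).det = Real.sqrt Y.det := by
    simpa using hY.posSemidef.det_sqrt
  have hpow : Real.sqrt Y.det ^ α = Y.det ^ ((α : ℝ) / 2) := by
    rw [Real.sqrt_eq_rpow, ← Real.rpow_natCast, ← Real.rpow_mul hY.det_pos.le]
    congr 1
    ring
  rw [modifiedPoly_of_harmonic h, toC_mul, hP, toC_det, hdet, ← Complex.ofReal_pow, hpow] at h1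
  have h0 : ((Y.det ^ ((α : ℝ) / 2) : ℝ) : ℂ) ≠ 0 :=
    Complex.ofReal_ne_zero.2 (Real.rpow_pos_of_pos hY.det_pos _).ne'
  exact (mul_left_cancel₀ h0 h1).symm

lemma theta_of_harmonic {α : ℕ} {A : Matrix (Fin m) (Fin m) ℤ} (hA : (toR A).PosDef)
    {P : MvPolynomial (Fin m × Fin n) ℂ} (hP : IsDetHomogeneous α P) (h : trLaplace A P = 0)
    (H K : Matrix (Fin m) (Fin n) ℝ) {Z : Matrix (Fin n) (Fin n) ℂ} (hZ : Z ∈ upperHalfSpace n) :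
    theta (α : ℤ) (modifiedPoly A P) A H K Z = ∑' R : Matrix (Fin m) (Fin n) ℤ,
      evalR P (vec (H + toR R)) *
        gaussian (toC (toR A) ⊗ₖ ((-Complex.I) • Z)) (vec (toR A * K)) (vec (H + toR R)) := by
  rw [theta_eq_tsum hA hP hZ]
  simp only [evalR_twistedPoly_of_harmonic hA hP h hZ.2]

theorem theta_of_harmonic_eq_classical {α : ℕ} {A : Matrix (Fin m) (Fin m) ℤ}
    (hA : (toR A).PosDef)
    {P : MvPolynomial (Fin m × Fin n) ℂ} (hP : IsDetHomogeneous α P) (h : trLaplace A P = 0)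
    (H K : Matrix (Fin m) (Fin n) ℝ) {Z : Matrix (Fin n) (Fin n) ℂ} (hZ : Z ∈ upperHalfSpace n) :
    theta (α : ℤ) (modifiedPoly A P) A H K Z = ∑' R : Matrix (Fin m) (Fin n) ℤ,
      evalMatrix P (toC (H + toR R)) * expFactor A K Z (H + toR R) := by
  rw [theta_of_harmonic hA hP h H K hZ]
  simp only [expFactor_eq_gaussian hA hZ.1]
  rfl

theorem differentiableOn_theta_of_harmonic {α : ℕ} {A : Matrix (Fin m) (Fin m) ℤ}
    (hA : (toR A).PosDef)
    {P : MvPolynomial (Fin m × Fin n) ℂ} (hP : IsDetHomogeneous α P) (h : trLaplace A P = 0)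
    (H K : Matrix (Fin m) (Fin n) ℝ) :
    DifferentiableOn ℂ (theta (α : ℤ) (modifiedPoly A P) A H K) (upperHalfSpace n) := by
  -- The entries of `A ⊗ (-iZ)` as linear functionals of all `n²` entries of `Z`, symmetric or not.
  -- The Gaussian series is differentiable at `Z` in the full matrix space; it is compared with
  -- `theta` on the half-space only.
  let b : Fin m × Fin n → Fin m × Fin n → (Fin n → Fin n → ℂ) →L[ℂ] ℂ := fun i j =>
    (toC (toR A) i.1 j.1 * (-Complex.I)) •
      ((ContinuousLinearMap.proj j.2).comp
        (ContinuousLinearMap.proj (R := ℂ) (φ := fun _ : Fin n => Fin n → ℂ) i.2))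
  have hb : ∀ Z : Matrix (Fin n) (Fin n) ℂ, (Matrix.of fun i j => b i j Z) =
      toC (toR A) ⊗ₖ ((-Complex.I) • Z) := by
    intro Z
    ext i j
    exact mul_assoc (toC (toR A) i.1 j.1) (-Complex.I) (Z i.2 j.2)
  intro Z hZ
  have hd := differentiableAt_tsum_gaussian b P (vec (toR A * K)) (vec H) (Z₀ := Z)
    (by rw [hb]; exact isCoercive_of_mem hA hZ)
  have hd' : DifferentiableAt ℂ (fun Z : Matrix (Fin n) (Fin n) ℂ =>
      ∑' R : Fin m × Fin n → ℤ, evalR P (vec H + intVec R) *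
        gaussian (Matrix.of fun i j => b i j Z) (vec (toR A * K)) (vec H + intVec R)) Z := hd
  have heq : ∀ W ∈ upperHalfSpace n, theta (α : ℤ) (modifiedPoly A P) A H K W =
      ∑' R : Fin m × Fin n → ℤ, evalR P (vec H + intVec R) *
        gaussian (Matrix.of fun i j => b i j W) (vec (toR A * K)) (vec H + intVec R) := by
    intro W hW
    rw [theta_of_harmonic hA hP h H K hW, ← (vecEquiv (m := m) (n := n)).tsum_eq, hb]
    rfl
  exact hd'.differentiableWithinAt.congr heq (heq Z hZ)

end Harmonic

/-! ### Even unimodular `A` -/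

section Modular

variable {m n : ℕ}

/-- Modulo 2, transposing the index pair cancels the off-diagonal terms against each other, and the
diagonal ones vanish because `B` has even diagonal. -/
lemma even_trace_mul {k : ℕ} {B S : Matrix (Fin k) (Fin k) ℤ} (hB : B.IsSymm) (hS : S.IsSymm)
    (hd : ∀ i, Even (B i i)) : Even (B * S).trace := by
  rw [even_iff_two_dvd]
  refine (ZMod.intCast_zmod_eq_zero_iff_dvd _ 2).1 ?_
  have h : (B * S).trace = ∑ x : Fin k × Fin k, B x.1 x.2 * S x.2 x.1 := by
    simp [Matrix.trace, Matrix.mul_apply, Fintype.sum_prod_type]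
  rw [h, Int.cast_sum]
  refine Finset.sum_involution (fun x _ => x.swap) (fun x _ => ?_) (fun x _ hx => ?_)
    (fun x _ => mem_univ _) (fun x _ => Prod.swap_swap x)
  · rw [Prod.fst_swap, Prod.snd_swap, hB.apply x.1 x.2, hS.apply x.2 x.1, ← two_mul]
    have : (2 : ZMod 2) = 0 := rfl
    rw [this, zero_mul]
  · intro hxx
    have h12 : x.2 = x.1 := congrArg Prod.fst hxx
    apply hx
    obtain ⟨c, hc⟩ := hd x.1
    rw [h12, hc, Int.cast_mul, Int.cast_add, ← two_mul]
    have : (2 : ZMod 2) = 0 := rfl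
    rw [this, zero_mul, zero_mul]

/-- With `r` the `k`-th column of `R`, the entry is `tr(A · r rᵀ)`. -/
lemma even_diag_conj {A : Matrix (Fin m) (Fin m) ℤ} (hA : A.IsSymm) (hd : ∀ i, Even (A i i))
    (R : Matrix (Fin m) (Fin n) ℤ) (k : Fin n) : Even ((R.transpose * A * R) k k) := by
  have h := even_trace_mul hA
    (S := Matrix.of fun i j => R i k * R j k) (by ext i j; simp [mul_comm]) hd
  convert h using 1
  simp only [Matrix.trace, Matrix.diag, Matrix.mul_apply, Matrix.transpose_apply, Matrix.of_apply,
    sum_mul]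
  rw [sum_comm]
  exact sum_congr rfl fun i _ => sum_congr rfl fun j _ => by ring

lemma toR_transpose {k l : ℕ} (B : Matrix (Fin k) (Fin l) ℤ) :
    toR B.transpose = (toR B).transpose := rfl

lemma toR_det {k : ℕ} (B : Matrix (Fin k) (Fin k) ℤ) : (toR B).det = (B.det : ℝ) :=
  ((Int.castRingHom ℝ).map_det B).symm

lemma isSymm_of_toR {A : Matrix (Fin m) (Fin m) ℤ} (hA : (toR A).PosDef) : A.IsSymm :=
  toR_injective (by rw [toR_transpose, (isSymm_of_posDef hA).eq])

/-- The exponent changes by `tr(RᵀARS)/2`, an integer. -/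
lemma expFactor_add {A : Matrix (Fin m) (Fin m) ℤ} (hA : (toR A).PosDef)
    (hd : ∀ i, Even (A i i)) (Z : Matrix (Fin n) (Fin n) ℂ) {S : Matrix (Fin n) (Fin n) ℤ}
    (hS : S.IsSymm) (K : Matrix (Fin m) (Fin n) ℝ) (R : Matrix (Fin m) (Fin n) ℤ) :
    expFactor A K (Z + toC (toR S)) (toR R) = expFactor A K Z (toR R) := by
  have hAs := isSymm_of_toR hA
  have hBs : (R.transpose * A * R).IsSymm := by
    rw [Matrix.IsSymm, Matrix.transpose_mul, Matrix.transpose_mul, Matrix.transpose_transpose,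
      hAs.eq, Matrix.mul_assoc]
  obtain ⟨c, hc⟩ := even_trace_mul hBs hS (even_diag_conj hAs hd R)
  have h1 : (toC ((toR R).transpose * toR A * toR R) * toC (toR S)).trace = 2 * (c : ℂ) := by
    rw [← toR_transpose, ← toR_mul, ← toR_mul, ← toC_mul, ← toR_mul]
    have : (toC (toR (R.transpose * A * R * S))).trace =
        (((R.transpose * A * R * S).trace : ℤ) : ℂ) := by
      simp [Matrix.trace, toC, toR]
    rw [this, hc]
    push_cast
    ring
  rw [expFactor, expFactor, Matrix.mul_add, Matrix.trace_add, h1, e, e]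
  refine Complex.exp_eq_exp_iff_exists_int.2 ⟨c, ?_⟩
  ring

theorem theta_add_of_even {A : Matrix (Fin m) (Fin m) ℤ} (hA : (toR A).PosDef)
    (hd : ∀ i, Even (A i i)) (l : ℤ) (f : Matrix (Fin m) (Fin n) ℝ → ℂ)
    (Z : Matrix (Fin n) (Fin n) ℂ) {S : Matrix (Fin n) (Fin n) ℤ} (hS : S.IsSymm) :
    theta l f A 0 0 (Z + toC (toR S)) = theta l f A 0 0 Z := by
  have him : (Z + toC (toR S)).map Complex.im = Z.map Complex.im := by
    ext i j; simp [toC]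
  rw [theta, theta, him]
  congr 1
  refine tsum_congr fun R => ?_
  rw [thetaTerm, thetaTerm, him, zero_add, expFactor_add hA hd Z hS]

/-- The inverse of `A` is its adjugate, which is integral, so the quotient is trivial. -/
lemma isRepSystem_singleton_zero {A : Matrix (Fin m) (Fin m) ℤ} (hA : (toR A).PosDef)
    (hdet : A.det = 1) : IsRepSystem A {(0 : Matrix (Fin m) (Fin n) ℝ)} := by
  have h : ∀ R : Matrix (Fin m) (Fin n) ℤ, (toR A)⁻¹ * toR R = toR (A.adjugate * R) := by
    intro R
    rw [← inv_mul_toR_mul hA (A.adjugate * R), ← Matrix.mul_assoc, Matrix.mul_adjugate, hdet, one_smul,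
      Matrix.one_mul]
  refine ⟨fun J hJ => ⟨0, ?_⟩, fun R => ⟨0, ⟨mem_singleton_self _, A.adjugate * R, ?_⟩, ?_⟩⟩
  · rw [mem_singleton.1 hJ, toR_zero, Matrix.mul_zero]
  · rw [sub_zero, h]
  · rintro J ⟨hJ, -⟩
    exact mem_singleton.1 hJ

theorem theta_neg_inv_of_unimodular {α : ℕ} {A : Matrix (Fin m) (Fin m) ℤ} (hA : (toR A).PosDef)
    {P : MvPolynomial (Fin m × Fin n) ℂ} (hP : IsDetHomogeneous α P) (hdet : A.det = 1)
    (hm : 8 ∣ m) {Z : Matrix (Fin n) (Fin n) ℂ} (hZ : Z ∈ upperHalfSpace n) :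
    theta (α : ℤ) (modifiedPoly A P) A 0 0 (-Z⁻¹) =
      Z.det ^ (m / 2 + α) * theta (α : ℤ) (modifiedPoly A P) A 0 0 Z := by
  obtain ⟨r, hr⟩ := exists_isDetRoot n
  rw [theta_transformation hA hP hr (isRepSystem_singleton_zero hA hdet) 0 0 hZ, toR_det, hdet,
    ← hr.2.1 Z hZ, ← pow_mul]
  obtain ⟨k, rfl⟩ := hm
  -- The exponent `-mn/2` is `-4kn`, so divisibility of `m` by `8` makes this factor `1` for every
  -- `n`.
  have h1 : Complex.I ^ (-(((8 * k : ℕ) : ℂ) * (n : ℂ)) / 2) = 1 := by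
    have : -(((8 * k : ℕ) : ℂ) * (n : ℂ)) / 2 = -((4 * (k * n) : ℕ) : ℂ) := by push_cast; ring
    rw [this, Complex.cpow_neg, Complex.cpow_natCast, pow_mul, Complex.I_pow_four, one_pow, inv_one]
  have h2 : 2 * (8 * k / 2 + α) = 8 * k + 2 * α := by omega
  rw [h1, h2]
  simp [e]

end Modular

end SiegelTheta
end

theorem mainTheorem3 (m n α : ℕ) (A : Matrix (Fin m) (Fin m) ℤ)
    (hA : (SiegelTheta.toR A).PosDef)
    (P : MvPolynomial (Fin m × Fin n) ℂ) (hP : SiegelTheta.IsDetHomogeneous α P) :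
    -- absolute convergence of all the theta series
    (∀ (H K : Matrix (Fin m) (Fin n) ℝ), ∀ Z ∈ SiegelTheta.upperHalfSpace n,
      Summable (fun R : Matrix (Fin m) (Fin n) ℤ =>
        SiegelTheta.thetaTerm (SiegelTheta.modifiedPoly A P) A K Z (H + SiegelTheta.toR R))) ∧
    -- the quotient is finite, and the branch of the square root of `det Z` exists
    (∃ 𝒥 : Finset (Matrix (Fin m) (Fin n) ℝ), SiegelTheta.IsRepSystem A 𝒥) ∧
    (∃ r : Matrix (Fin n) (Fin n) ℂ → ℂ, SiegelTheta.IsDetRoot n r) ∧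
    -- the transformation formula
    (∀ r : Matrix (Fin n) (Fin n) ℂ → ℂ, SiegelTheta.IsDetRoot n r →
      ∀ 𝒥 : Finset (Matrix (Fin m) (Fin n) ℝ), SiegelTheta.IsRepSystem A 𝒥 →
      ∀ (H K : Matrix (Fin m) (Fin n) ℝ), ∀ Z ∈ SiegelTheta.upperHalfSpace n,
        -Z⁻¹ ∈ SiegelTheta.upperHalfSpace n ∧
        SiegelTheta.theta (α : ℤ) (SiegelTheta.modifiedPoly A P) A H K (-Z⁻¹) =
          Complex.I ^ (-((m : ℂ) * (n : ℂ)) / 2) *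
          (((SiegelTheta.toR A).det ^ (-(n : ℝ) / 2) : ℝ) : ℂ) *
          r Z ^ (m + 2 * α) *
          SiegelTheta.e (((H.transpose * SiegelTheta.toR A * K).trace : ℝ) : ℂ) *
          ∑ J ∈ 𝒥,
            SiegelTheta.theta (α : ℤ) (SiegelTheta.modifiedPoly A P) A (J + K) (-H) Z) ∧
    -- for `m` even or `n = 1`, the power of `det Z` is the principal one
    (∀ r : Matrix (Fin n) (Fin n) ℂ → ℂ, SiegelTheta.IsDetRoot n r → (Even m ∨ n = 1) →
      ∀ Z ∈ SiegelTheta.upperHalfSpace n,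
        r Z ^ (m + 2 * α) = Z.det ^ ((m : ℂ) / 2 + (α : ℂ))) ∧
    -- the harmonic case: the series is the classical one, and it is holomorphic
    (SiegelTheta.trLaplace A P = 0 →
      ∀ H K : Matrix (Fin m) (Fin n) ℝ,
        (∀ Z ∈ SiegelTheta.upperHalfSpace n,
          SiegelTheta.theta (α : ℤ) (SiegelTheta.modifiedPoly A P) A H K Z =
            ∑' R : Matrix (Fin m) (Fin n) ℤ,
              SiegelTheta.evalMatrix P (SiegelTheta.toC (H + SiegelTheta.toR R)) *
                SiegelTheta.expFactor A K Z (H + SiegelTheta.toR R)) ∧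
        DifferentiableOn ℂ
          (SiegelTheta.theta (α : ℤ) (SiegelTheta.modifiedPoly A P) A H K)
          (SiegelTheta.upperHalfSpace n)) ∧
    -- the even unimodular case: weight `m / 2 + α` for the generators of the Siegel modular group
    (A.det = 1 → (∀ i, Even (A i i)) → 8 ∣ m →
      ∀ Z ∈ SiegelTheta.upperHalfSpace n,
        (∀ S : Matrix (Fin n) (Fin n) ℤ, S.IsSymm →
          SiegelTheta.theta (α : ℤ) (SiegelTheta.modifiedPoly A P) A 0 0
              (Z + SiegelTheta.toC (SiegelTheta.toR S)) =
            SiegelTheta.theta (α : ℤ) (SiegelTheta.modifiedPoly A P) A 0 0 Z) ∧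
        SiegelTheta.theta (α : ℤ) (SiegelTheta.modifiedPoly A P) A 0 0 (-Z⁻¹) =
          Z.det ^ (m / 2 + α) *
            SiegelTheta.theta (α : ℤ) (SiegelTheta.modifiedPoly A P) A 0 0 Z) := by
  open SiegelTheta in
  exact ⟨fun H K Z hZ => summable_thetaTerm hA hP hZ H K, exists_isRepSystem hA,
    exists_isDetRoot n,
    fun r hr 𝒥 h𝒥 H K Z hZ => ⟨neg_inv_mem hZ, theta_transformation hA hP hr h𝒥 H K hZ⟩,
    fun r hr h Z hZ => isDetRoot_pow_eq_cpow hr h hZ,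
    fun h H K => ⟨fun Z hZ => theta_of_harmonic_eq_classical hA hP h H K hZ,
      differentiableOn_theta_of_harmonic hA hP h H K⟩,
    fun hdet hd hm Z hZ => ⟨fun S hS => theta_add_of_even hA hd _ _ Z hS,
      theta_neg_inv_of_unimodular hA hP hdet hm hZ⟩⟩
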